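/- **Setting.** Let $V$ be a finite dimensional $\mathbb Q$-vector space, $R\subset V$ an irreducible, reduced, finite (crystallographic) root system with a fixed set $\Pi$ of simple roots, $\tilde\alpha$ its highest root, $X\subset V$ the weight lattice, and $\widehat X=X\oplus\mathbb Z$. The affine Weyl group $\widehat W$ is generated by the affine reflections $s_{\alpha,n}(v)=v-(\langle\alpha,v\rangle-n)\alpha^\vee$ of $V^*$ ($\alpha\in R$, $n\in\mathbb Z$). It acts on $V\oplus\mathbb Q$, regarded as the space of affine functions $(\lambda,m):v\mapsto\langle\lambda,v\rangle+m$ on $V^*$, by $(wf)(v)=f(w^{-1}v)$; this action preserves $\widehat X$. The affine roots are the pairs $\gamma=(\alpha,n)\in\widehat X$ with $\alpha\in R$, $n\in\mathbb Z$, and $s_{(\alpha,n)}:=s_{\alpha,-n}$; $\gamma$ is positive if $n>0$, or $n=0$ and $\alpha>0$. The simple affine roots are the $(\alpha,0)$ with $\alpha\in\Pi$ and $(-\tilde\alpha,1)$; the corresponding reflections form the set $\widehat{\mathcal S}$ of simple reflections, with respect to which the length and the Bruhat order $\le$ on $\widehat W$ are taken. Let $\mathbb F$ be a field with $\operatorname{char}\mathbb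 F\ne2$, let $S$ be the symmetric algebra of $\widehat X\otimes_{\mathbb Z}\mathbb F$, graded with $\widehat X\otimes\mathbb F$ in degree $2$, and write $\bar\lambda=\lambda\otimes1$ for $\lambda\in\widehat X$. The moment graph $\widehat{\mathcal G}$ has vertex set $\widehat W$ and an edge labelled $\bar\alpha$ from $x$ to $y$ whenever $x<y$ and $y=s_\alpha x$ with $\alpha$ a positive affine root. For $I\subset\widehat W$, $\widehat{\mathcal G}_I$ is the full subgraph on $I$; it satisfies the GKM-property if the labels of any two distinct edges of it with a common vertex are not proportional. Let $s=(s_1,\dots,s_l)$ be a sequence in $\widehat{\mathcal S}$, $s_i=s_{\alpha_i}$ with $\alpha_i$ a simple affine root, and $s'=(s_1,\dots,s_{l-1})$. Let $I(s)$ be the set of the $2^l$ sequences obtained from $s$ by replacing some entries with a blank $\sqcup$, $\operatorname{ev}(\sigma)\in\widehat W$ the product of the nonblank entries of $\sigma$, $I(s)_x=\{\sigma\in I(s):\operatorname{ev}(\sigma)=x\}$ and $J(s)=\operatorname{ev}(I(s))$. For a simple affine root $\lambda$ let $c^\lambda$ act on $\bigoplus_{\sigma\in I(s)}S$ by $(c^\lambda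 f)_\sigma=\overline{\operatorname{ev}(\sigma)(\lambda)}\,f_\sigma$, and let $\Delta:\bigoplus_{I(s')}S\to\bigoplus_{I(s)}S$ be given by $\Delta(f)_{\sigma\sqcup}=\Delta(f)_{\sigma s_l}=f_\sigma$. Define $\mathcal X(\emptyset)=S$ and $\mathcal X(s)=\Delta(\mathcal X(s'))+c^{\alpha_l}\Delta(\mathcal X(s'))$, and let $\mathcal X(s)^x$ be the $S$-module of the restrictions of the elements of $\mathcal X(s)$ to $I(s)_x$. **Trees and products of paths.** For $x\in\widehat W$ define the plane tree $T(s,x)$, with edges oriented towards the root and labelled by a color in $\{-1,0,1\}$ and a simple affine root, as follows. $T(\emptyset,x)$ is a single vertex if $x=e$ and is empty otherwise. If $l>0$, write $\{x,xs_l\}=\{y,z\}$ with $y<z$. If $I(s')_y$ and $I(s')_z$ are both nonempty, $T(s,x)$ is obtained by joining $T(s',y)$ on the left and $T(s',z)$ on the right to a new root, by a right tilted and a left tilted edge respectively; these have colors $1,0$ if $x=z$ and $0,-1$ if $x=y$. If both are empty, $T(s,x)$ is empty. If exactly one is empty (then it is $I(s')_z$), $T(s,x)$ is obtained by joining $T(s',y)$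 to a new root by a vertical edge of color $0$ if $x=y$ and $1$ if $x=z$. The new edges carry the simple affine root $\alpha_l$; the root carried by an edge $\gamma$ is denoted by $r(\gamma)$. A maximal path goes from a leaf to the root. For a path $\pi=\pi_1\cdots\pi_i$ starting at a leaf, $[\pi]\in I((s_1,\dots,s_i))$ has $k$-th entry $s_k$ if the color of $\pi_k$ is nonzero and $\sqcup$ otherwise; $\operatorname{ev}(\pi):=\operatorname{ev}([\pi])$ and $\pi'=\pi_1\cdots\pi_{i-1}$. Put $b_\emptyset=1$; put $b_\pi=\Delta(b_{\pi'})$ if $\pi_i$ is vertical or right tilted, and $b_\pi=\Delta\bigl(\tfrac12\bigl(c^{r(\pi_i)}+\overline{\operatorname{ev}(\pi')(r(\pi_i))}\bigr)b_{\pi'}\bigr)$ if $\pi_i$ is left tilted. For paths $\pi,\rho$ of equal length starting at leaves put $(\pi,\rho)=(b_\pi)_{[\rho]}$. **Statement (Corollary 5).** Suppose that $\widehat{\mathcal G}_{J(s)}$ satisfies the GKM-property, and let $x\in\widehat W$. Let $\pi^{(1)},\dots,\pi^{(n)}$ be the maximal paths of $T(s,x)$, numbered by their leaves from left to right. Then $j\mapsto[\pi^{(j)}]$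 is a bijection from $\{1,\dots,n\}$ onto $I(s)_x$, and, writing $f(\pi^{(j)}):=f_{[\pi^{(j)}]}$, the $S$-module $\mathcal X(s)^x$ has a homogeneous $S$-basis $v_1,\dots,v_n$ such that $$v_i(\pi^{(j)})=(\pi^{(i)},\pi^{(j)})\qquad\text{for all }i,j=1,\dots,n.$$ The products are computed by the rule $(\emptyset,\emptyset)=1$ and, for all paths $\pi\lambda,\rho\mu$ of $T(s,x)$ of equal length that start at leaves and have last edges $\lambda,\mu$, $$(\pi\lambda,\rho\mu)=\begin{cases}(\pi,\rho)&\text{if $\lambda$ is vertical or right tilted,}\\[2pt]\dfrac{\overline{\operatorname{ev}(\pi)(r(\lambda))}+\overline{\operatorname{ev}(\rho)(r(\mu))}}2\,(\pi,\rho)&\text{if $\lambda$ is left tilted.}\end{cases}$$ -/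

import Mathlib

open scoped TensorProduct

noncomputable section

namespace BottSamelson

/-! ### Length and Bruhat order of a group with a set of generators -/

section Bruhat

variable {G : Type*} [Group G]

/-- Length of `x` with respect to a set `S` of generators. -/
def length (S : Set G) (x : G) : ℕ :=
  sInf {n | ∃ w : List G, (∀ t ∈ w, t ∈ S) ∧ w.prod = x ∧ w.length = n}

/-- The set of conjugates of elements of `S`. -/
def reflections (S : Set G) : Set G := {t | ∃ w : G, ∃ s ∈ S, t = w * s * w⁻¹}

/-- The Bruhat order: `x ≤ y` if there is a chain from `x` to `y` in which each step is a right
multiplication by a reflection that increases the length. -/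
def bruhatLE (S : Set G) : G → G → Prop :=
  Relation.ReflTransGen fun u w => (∃ t ∈ reflections S, w = u * t) ∧ length S u < length S w

/-- The strict Bruhat order. -/
def bruhatLT (S : Set G) (x y : G) : Prop := bruhatLE S x y ∧ x ≠ y

end Bruhat

/-! ### The affine Weyl group and its action on affine weights -/

section Affine

variable {ι V N : Type*} [AddCommGroup V] [Module ℚ V] [AddCommGroup N] [Module ℚ N]
variable (P : RootPairing ι ℚ V N)

/-- The affine reflection `s_{α,n} : v ↦ v - (⟨α, v⟩ - n) α^∨` of the space `N = V^*`. -/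
def affineReflection (i : ι) (n : ℤ) : N ≃ᵃ[ℚ] N :=
  (P.coreflection i).toAffineEquiv.trans (AffineEquiv.constVAdd ℚ N ((n : ℚ) • P.coroot i))

theorem affineReflection_apply (i : ι) (n : ℤ) (v : N) :
    affineReflection P i n v = v - (P.toLinearMap (P.root i) v - n) • P.coroot i := by
  simp only [affineReflection, AffineEquiv.trans_apply, AffineEquiv.constVAdd_apply,
    LinearEquiv.coe_toAffineEquiv, P.coreflection_apply, vadd_eq_add, RootPairing.root', sub_smul]
  abel

/-- The affine Weyl group: the group of transformations of `V^*` generated by the affine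
reflections. -/
def affineWeylGroup : Subgroup (N ≃ᵃ[ℚ] N) :=
  Subgroup.closure (Set.range fun p : ι × ℤ => affineReflection P p.1 p.2)

/-- The pairing `⟨(lam, m), (v, 1)⟩ = ⟨lam, v⟩ + m` of `V ⊕ ℚ` with the first level space. -/
def levelOnePairing (p : V × ℚ) (v : N) : ℚ := P.toLinearMap p.1 v + p.2

/-- The linear action on `V ⊕ ℚ` dual to the linearized action `w (v, m) = (w_lin v + m w(0), m)`
on `V^* ⊕ ℚ`. It is characterized by `levelOnePairing_act`. -/
def act (w : N ≃ᵃ[ℚ] N) (p : V × ℚ) : V × ℚ :=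
  (P.toLinearMap.toPerfPair.symm
      ((P.toLinearMap p.1).comp ((w⁻¹ : N ≃ᵃ[ℚ] N).linear : N →ₗ[ℚ] N)),
    p.2 + P.toLinearMap p.1 ((w⁻¹ : N ≃ᵃ[ℚ] N) 0))

theorem levelOnePairing_act (w : N ≃ᵃ[ℚ] N) (p : V × ℚ) (v : N) :
    levelOnePairing P (act P w p) v = levelOnePairing P p ((w⁻¹ : N ≃ᵃ[ℚ] N) v) := by
  have h1 : P.toLinearMap (act P w p).1 v
      = P.toLinearMap p.1 ((w⁻¹ : N ≃ᵃ[ℚ] N).linear v) := by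
    change P.toLinearMap.toPerfPair _ v = _
    simp only [act, LinearEquiv.apply_symm_apply]
    rfl
  have h2 : (w⁻¹ : N ≃ᵃ[ℚ] N) v
      = (w⁻¹ : N ≃ᵃ[ℚ] N).linear v + (w⁻¹ : N ≃ᵃ[ℚ] N) 0 := by
    simpa using (w⁻¹ : N ≃ᵃ[ℚ] N).map_vadd 0 v
  rw [levelOnePairing, levelOnePairing, h1, h2, map_add]
  simp only [act]
  ring

theorem levelOnePairing_ext {p q : V × ℚ}
    (h : ∀ v, levelOnePairing P p v = levelOnePairing P q v) : p = q := by
  have h0 : p.2 = q.2 := by simpa [levelOnePairing] using h 0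
  have h1 : p.1 = q.1 := by
    apply P.toLinearMap.toPerfPair.injective
    ext v
    have := h v
    simp only [levelOnePairing, h0, add_left_inj] at this
    exact this
  exact Prod.ext h1 h0

theorem act_one (p : V × ℚ) : act P 1 p = p :=
  levelOnePairing_ext P fun v => by rw [levelOnePairing_act]; simp

theorem act_mul (w w' : N ≃ᵃ[ℚ] N) (p : V × ℚ) :
    act P (w * w') p = act P w (act P w' p) :=
  levelOnePairing_ext P fun v => by
    simp only [levelOnePairing_act, mul_inv_rev]
    rfl

theorem affineReflection_mul_self (i : ι) (n : ℤ) :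
    affineReflection P i n * affineReflection P i n = 1 := by
  ext v
  change affineReflection P i n (affineReflection P i n v) = v
  simp only [affineReflection_apply, map_sub, map_smul, P.root_coroot_two, smul_eq_mul]
  module

theorem affineReflection_inv (i : ι) (n : ℤ) :
    (affineReflection P i n)⁻¹ = affineReflection P i n :=
  inv_eq_of_mul_eq_one_right (affineReflection_mul_self P i n)

theorem act_affineReflection (i : ι) (n : ℤ) (p : V × ℚ) :
    act P (affineReflection P i n) p
      = (p.1 - P.toLinearMap p.1 (P.coroot i) • P.root i,
          p.2 + n * P.toLinearMap p.1 (P.coroot i)) :=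
  levelOnePairing_ext P fun v => by
    rw [levelOnePairing_act, affineReflection_inv, affineReflection_apply]
    simp only [levelOnePairing, map_sub, map_smul, LinearMap.sub_apply, LinearMap.smul_apply,
      smul_eq_mul]
    ring

/-- The lattice `X ⊕ ℤ` of affine weights, where `X` is the lattice of all `lam` with
`⟨lam, α^∨⟩ ∈ ℤ` for all roots `α`. -/
def affineWeightLattice : AddSubgroup (V × ℚ) where
  carrier := {p | (∀ i, ∃ k : ℤ, P.toLinearMap p.1 (P.coroot i) = k) ∧ ∃ k : ℤ, p.2 = k}
  zero_mem' := ⟨fun i => ⟨0, by simp⟩, ⟨0, by simp⟩⟩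
  add_mem' := by
    rintro p q ⟨hp, a, ha⟩ ⟨hq, c, hc⟩
    refine ⟨fun i => ?_, a + c, by simp [ha, hc]⟩
    obtain ⟨k, hk⟩ := hp i
    obtain ⟨m, hm⟩ := hq i
    exact ⟨k + m, by simp [hk, hm]⟩
  neg_mem' := by
    rintro p ⟨hp, a, ha⟩
    refine ⟨fun i => ?_, -a, by simp [ha]⟩
    obtain ⟨k, hk⟩ := hp i
    exact ⟨-k, by simp [hk]⟩

theorem root_mem_affineWeightLattice [P.IsCrystallographic] (i : ι) (n : ℤ) :
    (P.root i, (n : ℚ)) ∈ affineWeightLattice P :=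
  ⟨fun j => by
    obtain ⟨k, hk⟩ := P.exists_value (S := ℤ) i j
    exact ⟨k, hk.symm⟩, ⟨n, rfl⟩⟩

theorem act_mem_affineWeightLattice [P.IsCrystallographic] {w : N ≃ᵃ[ℚ] N}
    (hw : w ∈ affineWeylGroup P) {p : V × ℚ} (hp : p ∈ affineWeightLattice P) :
    act P w p ∈ affineWeightLattice P := by
  have gen : ∀ (i : ι) (n : ℤ) (p : V × ℚ), p ∈ affineWeightLattice P →
      act P (affineReflection P i n) p ∈ affineWeightLattice P := by
    rintro i n p ⟨hp, a, ha⟩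
    rw [act_affineReflection]
    obtain ⟨k, hk⟩ := hp i
    refine ⟨fun j => ?_, a + n * k, by simp [ha, hk]⟩
    obtain ⟨m, hm⟩ := hp j
    obtain ⟨c, hc⟩ := P.exists_value (S := ℤ) i j
    refine ⟨m - k * c, ?_⟩
    have hc' : P.toLinearMap (P.root i) (P.coroot j) = c := hc.symm
    simp [hm, hk, hc', -RootPairing.root_coroot_eq_pairing]
  have key : (∀ p ∈ affineWeightLattice P, act P w p ∈ affineWeightLattice P) ∧
      (∀ p ∈ affineWeightLattice P, act P w⁻¹ p ∈ affineWeightLattice P) := by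
    induction hw using Subgroup.closure_induction with
    | mem w h =>
      obtain ⟨⟨i, n⟩, rfl⟩ := h
      exact ⟨gen i n, by simpa only [affineReflection_inv] using gen i n⟩
    | one => simp [act_one]
    | mul a c _ _ ha hc =>
      refine ⟨fun p hp => ?_, fun p hp => ?_⟩
      · rw [act_mul]
        exact ha.1 _ (hc.1 _ hp)
      · rw [mul_inv_rev, act_mul]
        exact hc.2 _ (ha.2 _ hp)
    | inv a _ ha => exact ⟨ha.2, by simpa using ha.1⟩
  exact key.1 p hp

/-- The reflection `s_{(α,n)} = s_{α,-n}` attached to the affine root `(α, n)`. -/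
def rootReflection (g : ι × ℤ) : affineWeylGroup P :=
  ⟨affineReflection P g.1 (-g.2), Subgroup.subset_closure ⟨(g.1, -g.2), rfl⟩⟩

theorem rootReflection_mul_self (g : ι × ℤ) : rootReflection P g * rootReflection P g = 1 :=
  Subtype.ext (affineReflection_mul_self P g.1 (-g.2))

/-! ### Positive and simple affine roots -/

variable {P} (b : P.Base)

/-- The positive affine roots: `(α, n)` with `n > 0`, and `(α, 0)` with `α` positive. -/
def IsPosAffineRoot (g : ι × ℤ) : Prop := 0 < g.2 ∨ (g.2 = 0 ∧ b.IsPos g.1)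

/-- `α_j` is the highest root: every `α_j - α_i` is a sum of simple roots. -/
def IsHighestRoot (j : ι) : Prop :=
  ∀ i, P.root j - P.root i ∈ AddSubmonoid.closure (P.root '' b.support)

/-- The simple affine roots: `(α, 0)` with `α` simple, and `(-θ, 1)` with `θ` the highest root. -/
def simpleAffineRoots : Set (ι × ℤ) :=
  {g | (g.2 = 0 ∧ g.1 ∈ b.support) ∨
    (g.2 = 1 ∧ ∃ j, IsHighestRoot b j ∧ P.root g.1 = -P.root j)}

/-- The simple reflections. -/
def simpleReflections : Set (affineWeylGroup P) := rootReflection P '' simpleAffineRoots b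

/-! ### The moment graph -/

/-- Edges of the moment graph: `x → y` if `x < y` in the Bruhat order and `y = s_α x` with `α` a
positive affine root. -/
structure Edge where
  src : affineWeylGroup P
  tgt : affineWeylGroup P
  root : ι × ℤ
  pos : IsPosAffineRoot b root
  lt : bruhatLT (simpleReflections b) src tgt
  eq : tgt = rootReflection P root * src

/-! ### Subsequences

A sequence of simple reflections is given by the sequence of the corresponding simple affine roots.
A subsequence of a sequence of length `l` is a function `Fin l → Bool`, the value `false` marking
the entries that are replaced with a blank. -/

variable {b}

/-- The product of the entries of a subsequence. -/
def ev {l : ℕ} (s : Fin l → simpleAffineRoots b) (sub : Fin l → Bool) : affineWeylGroup P :=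
  (List.ofFn fun i => if sub i then rootReflection P (s i).1 else 1).prod

/-- The set `I(s)_x` of subsequences with product `x`. -/
def subseqsAt {l : ℕ} (s : Fin l → simpleAffineRoots b) (x : affineWeylGroup P) :
    Set (Fin l → Bool) := {sub | ev s sub = x}

/-- The set `J(s)` of products of subsequences. -/
def evSet {l : ℕ} (s : Fin l → simpleAffineRoots b) : Set (affineWeylGroup P) := Set.range (ev s)

theorem ev_succ {l : ℕ} (s : Fin (l + 1) → simpleAffineRoots b) (sub : Fin (l + 1) → Bool) :
    ev s sub = ev (Fin.init s) (Fin.init sub) *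
      (if sub (Fin.last l) then rootReflection P (s (Fin.last l)).1 else 1) := by
  simp only [ev, List.ofFn_succ', List.prod_concat]
  rfl

/-! ### Affine weights over `F` and the GKM-property -/

variable (P) [P.IsCrystallographic]

/-- The action of the affine Weyl group on the affine weights. -/
def weylAct (w : affineWeylGroup P) (lam : affineWeightLattice P) : affineWeightLattice P :=
  ⟨act P w.1 lam.1, act_mem_affineWeightLattice P w.2 lam.2⟩

/-- A pair `(i, n)` indexes the affine root `(α_i, n)`. -/
def affineRoot (g : ι × ℤ) : affineWeightLattice P :=
  ⟨(P.root g.1, (g.2 : ℚ)), root_mem_affineWeightLattice P g.1 g.2⟩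

variable (F : Type*) [Field F]

/-- The space of affine weights over `F`. -/
abbrev WeightSpace := F ⊗[ℤ] (affineWeightLattice P)

/-- The symmetric algebra `S`. -/
abbrev SymAlg := SymmetricAlgebra F (WeightSpace P F)

/-- The image of an affine weight in the space of weights over `F`. -/
def wt (lam : affineWeightLattice P) : WeightSpace P F := (1 : F) ⊗ₜ[ℤ] lam

/-- The image of an affine weight in `S`. -/
def bar (lam : affineWeightLattice P) : SymAlg P F :=
  SymmetricAlgebra.ι F (WeightSpace P F) (wt P F lam)

/-- The component of degree `d` of `S`, graded so that weights have degree `2`. -/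
def symGrade (d : ℤ) : Submodule F (SymAlg P F) :=
  if 0 ≤ d ∧ Even d then
    (LinearMap.range (SymmetricAlgebra.ι F (WeightSpace P F))) ^ (d / 2).toNat
  else ⊥

/-- A function with values in `S` is homogeneous if all its values lie in one degree. -/
def IsHomogeneousFun {A : Type*} (f : A → SymAlg P F) : Prop :=
  ∃ d : ℤ, ∀ a, f a ∈ symGrade P F d

variable {P} (b)

/-- The GKM-property of the full subgraph with vertex set `I`: the labels of two distinct edges
with a common vertex are not proportional. -/
def GKM (I : Set (affineWeylGroup P)) : Prop :=
  ∀ E E' : Edge b, E ≠ E' → E.src ∈ I → E.tgt ∈ I → E'.src ∈ I → E'.tgt ∈ I →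
    (E.src = E'.src ∨ E.src = E'.tgt ∨ E.tgt = E'.src ∨ E.tgt = E'.tgt) →
    ∀ c : F, wt P F (affineRoot P E'.root) ≠ c • wt P F (affineRoot P E.root)

variable {b}

/-! ### The modules `X(s)` and `X(s)^x` -/

/-- The diagonal embedding. -/
def diag {l : ℕ} :
    ((Fin l → Bool) → SymAlg P F) →ₗ[SymAlg P F] ((Fin (l + 1) → Bool) → SymAlg P F) where
  toFun f := fun sub => f (Fin.init sub)
  map_add' _ _ := rfl
  map_smul' _ _ := rfl

/-- The action of the element `c^lam` of the structure algebra. -/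
def cAct (lam : affineWeightLattice P) {l : ℕ} (s : Fin l → simpleAffineRoots b) :
    ((Fin l → Bool) → SymAlg P F) →ₗ[SymAlg P F] ((Fin l → Bool) → SymAlg P F) where
  toFun f := fun sub => bar P F (weylAct P (ev s sub) lam) * f sub
  map_add' f g := by
    funext sub
    simp [mul_add]
  map_smul' a f := by
    funext sub
    simp [mul_left_comm]

/-- The module `X(s)`. -/
def X : {l : ℕ} → (s : Fin l → simpleAffineRoots b) →
    Submodule (SymAlg P F) ((Fin l → Bool) → SymAlg P F)
  | 0, _ => ⊤
  | l + 1, s =>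
    (X (Fin.init s)).map (diag F) ⊔
      (X (Fin.init s)).map (cAct F (affineRoot P (s (Fin.last l)).1) s ∘ₗ diag F)

/-- The module `X(s)^x` of restrictions of elements of `X(s)` to `I(s)_x`. -/
def XAt {l : ℕ} (s : Fin l → simpleAffineRoots b) (x : affineWeylGroup P) :
    Submodule (SymAlg P F) (subseqsAt s x → SymAlg P F) :=
  (X F s).map (LinearMap.funLeft (SymAlg P F) (SymAlg P F)
    (Subtype.val : subseqsAt s x → (Fin l → Bool)))

end Affine

/-! ### Trees and paths -/

/-- The direction in which an edge is drawn. -/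
inductive Tilt
  | vertical
  | right
  | left

/-- An edge of a tree, with its color, its root and its direction. -/
structure TreeEdge (A : Type*) where
  color : SignType
  root : A
  tilt : Tilt

/-- Plane trees in which all leaves have level `0` and the root has level `l`; the edges point to
the root and are labelled by a color and an element of `A`. `one c r T` has a single (vertical)
edge of level `l + 1`; `two c₁ c₂ r T₁ T₂` has `T₁` on the left, joined to the root by a right
tilted edge of color `c₁`, and `T₂` on the right, joined by a left tilted edge of color `c₂`. -/
inductive Tree (A : Type*) : ℕ → Type _
  | empty (l : ℕ) : Tree A l
  | leaf : Tree A 0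
  | one {l : ℕ} (c : SignType) (r : A) (T : Tree A l) : Tree A (l + 1)
  | two {l : ℕ} (c₁ c₂ : SignType) (r : A) (T₁ T₂ : Tree A l) : Tree A (l + 1)

/-- The maximal paths from the leaves to the root, listed by their leaves from left to right. -/
def Tree.maxPaths {A : Type*} : {l : ℕ} → Tree A l → List (Fin l → TreeEdge A)
  | _, .empty _ => []
  | _, .leaf => [Fin.elim0]
  | _, .one c r T => T.maxPaths.map fun p => Fin.snoc (α := fun _ => TreeEdge A) p ⟨c, r, .vertical⟩
  | _, .two c₁ c₂ r T₁ T₂ =>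
    (T₁.maxPaths.map fun p => Fin.snoc (α := fun _ => TreeEdge A) p ⟨c₁, r, .right⟩) ++
      (T₂.maxPaths.map fun p => Fin.snoc (α := fun _ => TreeEdge A) p ⟨c₂, r, .left⟩)

/-- `p` is a path of length `k` starting at a leaf: as the edges point to the root, it is an initial
segment of a maximal path. -/
def Tree.IsLeafPath {A : Type*} {l : ℕ} (T : Tree A l) {k : ℕ} (hk : k ≤ l)
    (p : Fin k → TreeEdge A) : Prop :=
  ∃ q ∈ T.maxPaths, p = Fin.take k hk q

section Paths

variable {ι V N : Type*} [AddCommGroup V] [Module ℚ V] [AddCommGroup N] [Module ℚ N]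
variable {P : RootPairing ι ℚ V N} {b : P.Base}

open Classical in
/-- The tree `T(s, x)`. In the recursive step `{x, x s_l} = {y, z}` with `y < z`. -/
def tree : {l : ℕ} → (s : Fin l → simpleAffineRoots b) → (x : affineWeylGroup P) →
    Tree (simpleAffineRoots b) l
  | 0, _, x => if x = 1 then .leaf else .empty 0
  | l + 1, s, x =>
    let r := s (Fin.last l)
    let x' := x * rootReflection P r.1
    if (subseqsAt (Fin.init s) x).Nonempty ∧ (subseqsAt (Fin.init s) x').Nonempty then
      if bruhatLT (simpleReflections b) x x' then
        .two 0 (-1) r (tree (Fin.init s) x) (tree (Fin.init s) x')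
      else
        .two 1 0 r (tree (Fin.init s) x') (tree (Fin.init s) x)
    else if (subseqsAt (Fin.init s) x).Nonempty ∨ (subseqsAt (Fin.init s) x').Nonempty then
      if bruhatLT (simpleReflections b) x x' then
        .one 0 r (tree (Fin.init s) x)
      else
        .one 1 r (tree (Fin.init s) x')
    else .empty (l + 1)

/-- The subsequence `[π]` of a path `π`: the entries at edges of nonzero color are kept. -/
def pathSeq {A : Type*} {l : ℕ} (p : Fin l → TreeEdge A) : Fin l → Bool :=
  fun i => decide ((p i).color ≠ 0)

theorem pathSeq_snoc {A : Type*} {l : ℕ} (p : Fin l → TreeEdge A) (e : TreeEdge A) :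
    Fin.init (pathSeq (Fin.snoc (α := fun _ => TreeEdge A) p e)) = pathSeq p ∧
      pathSeq (Fin.snoc (α := fun _ => TreeEdge A) p e) (Fin.last l) = decide (e.color ≠ 0) := by
  constructor
  · funext i
    simp [pathSeq, Fin.init]
  · simp [pathSeq]

/-- The subsequence of a maximal path of `T(s, x)` has product `x`. -/
theorem pathSeq_mem {l : ℕ} (s : Fin l → simpleAffineRoots b) (x : affineWeylGroup P)
    (p : Fin l → TreeEdge (simpleAffineRoots b)) (hp : p ∈ (tree s x).maxPaths) :
    pathSeq p ∈ subseqsAt s x := by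
  induction l generalizing x with
  | zero =>
    unfold tree at hp
    split_ifs at hp with h
    · simp [subseqsAt, ev, h]
    · simp [Tree.maxPaths] at hp
  | succ l ih =>
    have step0 : ∀ q ∈ (tree (Fin.init s) x).maxPaths,
        ∀ t r, pathSeq (Fin.snoc (α := fun _ => TreeEdge (simpleAffineRoots b)) q ⟨0, r, t⟩)
          ∈ subseqsAt s x := by
      intro q hq t r
      obtain ⟨h1, h2⟩ := pathSeq_snoc q ⟨0, r, t⟩
      have h3 : ev (Fin.init s) (pathSeq q) = x := ih _ _ q hq
      change ev s _ = x
      rw [ev_succ, h1, h2, h3]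
      simp
    have step1 : ∀ q ∈ (tree (Fin.init s) (x * rootReflection P (s (Fin.last l)).1)).maxPaths,
        ∀ c : SignType, c ≠ 0 → ∀ t r,
          pathSeq (Fin.snoc (α := fun _ => TreeEdge (simpleAffineRoots b)) q ⟨c, r, t⟩)
            ∈ subseqsAt s x := by
      intro q hq c hc t r
      obtain ⟨h1, h2⟩ := pathSeq_snoc q ⟨c, r, t⟩
      have h3 : ev (Fin.init s) (pathSeq q) = x * rootReflection P (s (Fin.last l)).1 :=
        ih _ _ q hq
      change ev s _ = x
      rw [ev_succ, h1, h2, h3]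
      simp [hc, mul_assoc, rootReflection_mul_self]
    unfold tree at hp
    simp only at hp
    split_ifs at hp <;>
      simp only [Tree.maxPaths, List.mem_append, List.mem_map, List.not_mem_nil] at hp
    · rcases hp with ⟨q, hq, rfl⟩ | ⟨q, hq, rfl⟩
      · exact step0 q hq _ _
      · exact step1 q hq _ (by decide) _ _
    · rcases hp with ⟨q, hq, rfl⟩ | ⟨q, hq, rfl⟩
      · exact step1 q hq _ (by decide) _ _
      · exact step0 q hq _ _
    · obtain ⟨q, hq, rfl⟩ := hp
      exact step0 q hq _ _
    · obtain ⟨q, hq, rfl⟩ := hp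
      exact step1 q hq _ (by decide) _ _

/-- The number of leaves of `T(s, x)`. -/
def numLeaves {l : ℕ} (s : Fin l → simpleAffineRoots b) (x : affineWeylGroup P) : ℕ :=
  (tree s x).maxPaths.length

/-- The maximal path of `T(s, x)` starting at the leaf number `i`, counted from the left. -/
def maxPath {l : ℕ} (s : Fin l → simpleAffineRoots b) (x : affineWeylGroup P)
    (i : Fin (numLeaves s x)) : Fin l → TreeEdge (simpleAffineRoots b) :=
  (tree s x).maxPaths.get i

/-- The element of `I(s)_x` that is identified with the maximal path number `i`. -/
def maxPathSeq {l : ℕ} (s : Fin l → simpleAffineRoots b) (x : affineWeylGroup P)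
    (i : Fin (numLeaves s x)) : subseqsAt s x :=
  ⟨pathSeq (maxPath s x i), pathSeq_mem s x _ (List.get_mem _ i)⟩

variable [P.IsCrystallographic] (F : Type*) [Field F]

open Classical in
/-- The element `b_π` of `X((s_1, …, s_l))` for a path `π` of length `l` that starts at a leaf. -/
def pathElement : {l : ℕ} → (s : Fin l → simpleAffineRoots b) →
    (p : Fin l → TreeEdge (simpleAffineRoots b)) → (Fin l → Bool) → SymAlg P F
  | 0, _, _ => 1
  | l + 1, s, p =>
    let e := p (Fin.last l)
    let f := pathElement (Fin.init s) (Fin.init p)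
    if e.tilt = .left then
      diag F ((2 : F)⁻¹ • (cAct F (affineRoot P e.root.1) (Fin.init s) f +
        bar P F (weylAct P (ev (Fin.init s) (pathSeq (Fin.init p))) (affineRoot P e.root.1)) • f))
    else diag F f

/-- The product `(π, ρ)` of two paths of equal length. -/
def pathProduct {l : ℕ} (s : Fin l → simpleAffineRoots b)
    (p q : Fin l → TreeEdge (simpleAffineRoots b)) : SymAlg P F :=
  pathElement F s p (pathSeq q)

end Paths

end BottSamelson

end

/-! Write `s'` for `s` without its last entry, `α` for its last simple affine root and `{y, z} = {x,
x s_α}` with `y(α)` positive. Dropping the last entry identifies `I(s)_x` with `I(s')_y ⊔ I(s')_z`.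
As `c^α` acts by the scalar `x(α)` on `I(s)_x`, the module `X(s)^x` is the restriction of `X(s')` to
this union. There the elements `b_π` are block triangular: those ending in a left tilted edge vanish
over `y`, and over `z` they are `z(α)` times a path element of `T(s', z)`; the others restrict over
`y` to the path elements of `T(s', y)`.

So independence passes from `s'` to `s`, since `z(α)` is nonzero in the domain `S`. Spanning needs
one more fact (`EdgeDivisible`): an element of `X(s')` that vanishes over the lower end of an edge
is, over the upper end, the label times an element of `X(s')`. The basis property and edge
divisibility are proved together by induction on the length (`isPathBasis_succ`,
`edgeDivisible_succ`, joined in `isPathBasis_and_edgeDivisible`).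

The GKM-property enters only in divisibility. Two parallel edges give two quotients, over `u` and
over `u s_α`, which have to be merged into one (`exists_eq_bar_mul_of_pair`). The discrepancy is
controlled by comparing coefficients in a basis and by coprimality of nonproportional linear forms.

Bruhat-theoretic input is reduced to signs of affine roots: a simple reflection makes only its own
root negative (`isPosWt_simple`), whence strong exchange for words and for subexpressions
(`exchange_word`, `exchange_ev`). All of this is carried out for products of simple reflections and
for conjugates of simple reflections, so it is never needed that these generate the whole group. -/

noncomputable section

namespace BottSamelson

/-! ### Affine roots under the affine Weyl group -/

section AffineRoots

variable {ι V N : Type*} [AddCommGroup V] [Module ℚ V] [AddCommGroup N] [Module ℚ N]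
variable (P : RootPairing ι ℚ V N)

theorem act_add (w : N ≃ᵃ[ℚ] N) (p q : V × ℚ) : act P w (p + q) = act P w p + act P w q := by
  ext <;> simp [act, LinearMap.add_comp]
  ring

theorem rootReflection_inv (g : ι × ℤ) : (rootReflection P g)⁻¹ = rootReflection P g :=
  inv_eq_of_mul_eq_one_right (rootReflection_mul_self P g)

theorem mul_rootReflection_cancel (x : affineWeylGroup P) (g : ι × ℤ) :
    x * rootReflection P g * rootReflection P g = x := by
  rw [mul_assoc, rootReflection_mul_self, mul_one]

theorem rootReflection_cancel_left (x : affineWeylGroup P) (g : ι × ℤ) :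
    rootReflection P g * (rootReflection P g * x) = x := by
  rw [← mul_assoc, rootReflection_mul_self, one_mul]

variable [P.IsCrystallographic]

theorem weylAct_one (lam : affineWeightLattice P) : weylAct P 1 lam = lam :=
  Subtype.ext (act_one P _)

theorem weylAct_mul (w w' : affineWeylGroup P) (lam : affineWeightLattice P) :
    weylAct P (w * w') lam = weylAct P w (weylAct P w' lam) :=
  Subtype.ext (act_mul P _ _ _)

/-- The action of an element of the affine Weyl group as a homomorphism. -/
def weylHom (w : affineWeylGroup P) : affineWeightLattice P →+ affineWeightLattice P :=
  AddMonoidHom.mk' (weylAct P w) fun a c => Subtype.ext (act_add P w.1 a.1 c.1)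

theorem weylAct_add (w : affineWeylGroup P) (a c : affineWeightLattice P) :
    weylAct P w (a + c) = weylAct P w a + weylAct P w c := (weylHom P w).map_add a c

theorem weylAct_sub (w : affineWeylGroup P) (a c : affineWeightLattice P) :
    weylAct P w (a - c) = weylAct P w a - weylAct P w c := (weylHom P w).map_sub a c

theorem weylAct_neg (w : affineWeylGroup P) (a : affineWeightLattice P) :
    weylAct P w (-a) = -weylAct P w a := (weylHom P w).map_neg a

theorem weylAct_zsmul (w : affineWeylGroup P) (k : ℤ) (a : affineWeightLattice P) :
    weylAct P w (k • a) = k • weylAct P w a := (weylHom P w).map_zsmul k a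

theorem weylAct_inv_weylAct (w : affineWeylGroup P) (a : affineWeightLattice P) :
    weylAct P w⁻¹ (weylAct P w a) = a := by
  rw [← weylAct_mul, inv_mul_cancel, weylAct_one]

theorem weylAct_weylAct_inv (w : affineWeylGroup P) (a : affineWeightLattice P) :
    weylAct P w (weylAct P w⁻¹ a) = a := by
  rw [← weylAct_mul, mul_inv_cancel, weylAct_one]

theorem weylAct_rootReflection (g : ι × ℤ) (lam : affineWeightLattice P) {k : ℤ}
    (hk : P.toLinearMap lam.1.1 (P.coroot g.1) = k) :
    weylAct P (rootReflection P g) lam = lam - k • affineRoot P g := by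
  apply Subtype.ext
  change act P (affineReflection P g.1 (-g.2)) lam.1 = _
  rw [act_affineReflection, hk]
  ext
  · simp [affineRoot, Int.cast_smul_eq_zsmul]
  · simp [affineRoot]
    ring

theorem exists_weylAct_rootReflection (g : ι × ℤ) (lam : affineWeightLattice P) :
    ∃ k : ℤ, weylAct P (rootReflection P g) lam = lam - k • affineRoot P g := by
  obtain ⟨k, hk⟩ := lam.2.1 g.1
  exact ⟨k, weylAct_rootReflection P g lam hk⟩

theorem weylAct_rootReflection_self (g : ι × ℤ) :
    weylAct P (rootReflection P g) (affineRoot P g) = -affineRoot P g := by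
  rw [weylAct_rootReflection P g (affineRoot P g) (k := 2) (by simp [affineRoot])]
  module

theorem affineRoot_injective : Function.Injective (affineRoot P) := by
  intro g h e
  have e' := congrArg Subtype.val e
  simp only [affineRoot, Prod.mk.injEq, EmbeddingLike.apply_eq_iff_eq, Int.cast_inj] at e'
  exact Prod.ext e'.1 e'.2

/-- Both formulas compose, so it is enough to check them for reflections. Afterwards every translate
`wγ` can be treated as an affine root with reflection `w s_γ w⁻¹`. -/
theorem exists_affineRoot_eq_weylAct (w : affineWeylGroup P) (g : ι × ℤ) :
    ∃ g', affineRoot P g' = weylAct P w (affineRoot P g) ∧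
      rootReflection P g' = w * rootReflection P g * w⁻¹ := by
  have gen : ∀ (h : ι × ℤ) (g : ι × ℤ), ∃ g',
      affineRoot P g' = weylAct P (rootReflection P h) (affineRoot P g) ∧
      rootReflection P g' = rootReflection P h * rootReflection P g * (rootReflection P h)⁻¹ := by
    rintro ⟨k, m⟩ ⟨i, n⟩
    obtain ⟨p, hp⟩ := (affineRoot P (i, n)).2.1 k
    have hp' : P.toLinearMap (P.root i) (P.coroot k) = p := hp
    have hp2 : P.pairing i k = p := hp
    -- With `p` the pairing of `α_i` and the coroot of `α_k`, the image is `(α_i, n) - p (α_k, m)`.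
    refine ⟨(P.reflectionPerm k i, n - p * m), ?_, ?_⟩
    · rw [weylAct_rootReflection P (k, m) (affineRoot P (i, n)) hp]
      apply Subtype.ext
      ext
      · simp [affineRoot, P.root_reflectionPerm, P.reflection_apply, hp2, Int.cast_smul_eq_zsmul]
      · simp [affineRoot]
    · rw [rootReflection_inv]
      apply Subtype.ext
      ext v
      change affineReflection P (P.reflectionPerm k i) (-(n - p * m)) v =
        affineReflection P k (-m) (affineReflection P i (-n) (affineReflection P k (-m) v))
      simp only [affineReflection_apply, P.root_reflectionPerm, P.coroot_reflectionPerm,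
        P.reflection_apply, P.coreflection_apply, RootPairing.coroot', RootPairing.root',
        map_sub, map_smul, LinearMap.sub_apply, LinearMap.smul_apply, smul_eq_mul,
        LinearMap.flip_apply, hp',
        P.root_coroot_two]
      push_cast
      module
  obtain ⟨w, hw⟩ := w
  revert g
  refine Subgroup.closure_induction'' (p := fun w hw => ∀ g, ∃ g',
      affineRoot P g' = weylAct P ⟨w, hw⟩ (affineRoot P g) ∧
      rootReflection P g' = ⟨w, hw⟩ * rootReflection P g * (⟨w, hw⟩ : affineWeylGroup P)⁻¹)
    ?_ ?_ ?_ ?_ hw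
  · rintro _ ⟨⟨i, n⟩, rfl⟩ g
    have : (⟨affineReflection P i n, Subgroup.subset_closure ⟨(i, n), rfl⟩⟩ : affineWeylGroup P)
        = rootReflection P (i, -n) := Subtype.ext (by simp [rootReflection])
    rw [this]
    exact gen _ g
  · rintro _ ⟨⟨i, n⟩, rfl⟩ g
    have h : (⟨(affineReflection P i n)⁻¹, Subgroup.inv_mem _
        (Subgroup.subset_closure ⟨(i, n), rfl⟩)⟩ : affineWeylGroup P)
        = rootReflection P (i, -n) := Subtype.ext (by simp [rootReflection, affineReflection_inv])
    rw [h]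
    exact gen _ g
  · intro g
    refine ⟨g, (weylAct_one P _).symm, ?_⟩
    change _ = 1 * _ * (1 : affineWeylGroup P)⁻¹
    simp
  · intro x y hx hy h1 h2 g
    obtain ⟨g2, e2, r2⟩ := h2 g
    obtain ⟨g1, e1, r1⟩ := h1 g2
    refine ⟨g1, ?_, ?_⟩
    · rw [e1, e2, ← weylAct_mul]
      rfl
    · rw [r1, r2]
      change _ = (⟨x, hx⟩ * ⟨y, hy⟩) * _ * (⟨x, hx⟩ * ⟨y, hy⟩ : affineWeylGroup P)⁻¹
      group

end AffineRoots

/-! ### Positive affine roots and simple reflections -/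

section Positivity

variable {ι V N : Type*} [AddCommGroup V] [Module ℚ V] [AddCommGroup N] [Module ℚ N]
variable {P : RootPairing ι ℚ V N} (b : P.Base)

-- Maximality of `θ = α_j` is applied to the root `s_θ(α_i)`. Taking heights then bounds the pairing
-- from below without root strings.
variable {b} in
theorem IsHighestRoot.closure_mem {j : ι} (hj : IsHighestRoot b j) (i : ι) :
    (P.pairing i j + 1) • P.root j - P.root i ∈ AddSubmonoid.closure (P.root '' b.support) := by
  have h := hj (P.reflectionPerm j i)
  rw [P.root_reflectionPerm, P.reflection_apply_root] at h
  convert h using 1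
  module

section Height

variable [P.IsRootSystem]

/-- The linear form on `V` taking the value `1` on the simple roots. -/
def heightForm : V →ₗ[ℚ] ℚ := b.toWeightBasis.constr ℚ fun _ => (1 : ℚ)

theorem heightForm_simple {i : ι} (hi : i ∈ b.support) : heightForm b (P.root i) = 1 := by
  have := b.toWeightBasis.constr_basis ℚ (fun _ => (1 : ℚ)) ⟨i, hi⟩
  rwa [b.toWeightBasis_apply] at this

theorem heightForm_root (i : ι) : heightForm b (P.root i) = b.height i := by
  obtain ⟨f, -, -, hf⟩ := b.exists_root_eq_sum_int i
  rw [RootPairing.Base.height_eq_sum hf, hf, map_sum]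
  push_cast
  refine Finset.sum_congr rfl fun j hj => ?_
  rw [map_zsmul, heightForm_simple b hj]
  simp

theorem isPos_iff_heightForm {i : ι} : b.IsPos i ↔ 0 < heightForm b (P.root i) := by
  rw [heightForm_root, b.isPos_iff]
  simp

theorem heightForm_closure {x : V} (hx : x ∈ AddSubmonoid.closure (P.root '' b.support)) :
    0 ≤ heightForm b x ∧ (heightForm b x = 0 → x = 0) := by
  induction hx using AddSubmonoid.closure_induction with
  | mem x h =>
    obtain ⟨i, hi, rfl⟩ := h
    rw [heightForm_simple b hi]
    simp
  | zero => simp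
  | add x y _ _ hx hy =>
    rw [map_add]
    refine ⟨add_nonneg hx.1 hy.1, fun h => ?_⟩
    rw [hx.2 (by linarith [hx.1, hy.1]), hy.2 (by linarith [hx.1, hy.1]), add_zero]

theorem isPos_of_root_mem_closure {i : ι}
    (h : P.root i ∈ AddSubmonoid.closure (P.root '' b.support)) : b.IsPos i := by
  obtain ⟨h1, h2⟩ := heightForm_closure b h
  exact (isPos_iff_heightForm b).2 (lt_of_le_of_ne h1 fun e => P.ne_zero i (h2 e.symm))

theorem isPos_or_of_root_eq_neg {i j : ι} (h : P.root j = -P.root i) :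
    b.IsPos j ↔ ¬ b.IsPos i := by
  have h0 : heightForm b (P.root i) ≠ 0 := by
    rw [heightForm_root]
    exact_mod_cast b.height_ne_zero i
  rw [isPos_iff_heightForm, isPos_iff_heightForm, h, map_neg, not_lt, neg_pos]
  exact ⟨le_of_lt, fun h => lt_of_le_of_ne h h0⟩

variable {b}

/-- Comparing `θ` with `-θ` shows that `2θ` is a sum of simple roots. -/
theorem IsHighestRoot.isPos {j : ι} (hj : IsHighestRoot b j) : b.IsPos j := by
  rw [isPos_iff_heightForm]
  by_contra! h
  obtain ⟨k, hk⟩ : ∃ k, P.root k = -P.root j := ⟨P.reflectionPerm j j, by simp⟩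
  have h1 := hj k
  rw [hk, sub_neg_eq_add] at h1
  obtain ⟨h2, h3⟩ := heightForm_closure b h1
  rw [map_add] at h2 h3
  have h4 := h3 (by linarith)
  rw [← two_smul ℚ, smul_eq_zero] at h4
  exact P.ne_zero j (h4.resolve_left (by norm_num))

/-- If `p ≤ -1`, then `(p + 1)θ - α_i` has negative height, contrary to `closure_mem`. -/
theorem IsHighestRoot.pairing_nonneg {i j : ι} (hj : IsHighestRoot b j) (hi : b.IsPos i)
    {p : ℤ} (hp : P.pairing i j = p) : 0 ≤ p := by
  by_contra! h
  have h1 := (heightForm_closure b (hj.closure_mem i)).1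
  have h2 := (isPos_iff_heightForm b).1 hi
  have h3 := (isPos_iff_heightForm b).1 hj.isPos
  have h4 : (p : ℚ) + 1 ≤ 0 := by exact_mod_cast h
  rw [map_sub, map_smul, smul_eq_mul, hp] at h1
  nlinarith

/-- If `p ≤ -2`, nonnegativity of the height of `(p + 1)θ - α_i` gives `α_i + θ` height at most `0`.
But `α_i + θ = θ - (-α_i)` is a sum of simple roots, so it vanishes. -/
theorem IsHighestRoot.neg_one_le_pairing {i j : ι} (hj : IsHighestRoot b j)
    (hi : P.root i ≠ -P.root j) {p : ℤ} (hp : P.pairing i j = p) : -1 ≤ p := by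
  by_contra! h
  have h1 := (heightForm_closure b (hj.closure_mem i)).1
  have h3 := (isPos_iff_heightForm b).1 hj.isPos
  have h4 : (p : ℚ) + 2 ≤ 0 := by exact_mod_cast (by omega : p + 2 ≤ 0)
  obtain ⟨k, hk⟩ : ∃ k, P.root k = -P.root i := ⟨P.reflectionPerm i i, by simp⟩
  have h5 := hj k
  rw [hk, sub_neg_eq_add] at h5
  obtain ⟨h6, h7⟩ := heightForm_closure b h5
  rw [map_add] at h6 h7
  rw [map_sub, map_smul, smul_eq_mul, hp] at h1
  have h8 := h7 (by nlinarith)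
  exact hi (eq_neg_of_add_eq_zero_right h8)

end Height

variable {b} in
theorem simpleAffineRoots_isPos {a : ι × ℤ} (ha : a ∈ simpleAffineRoots b) :
    IsPosAffineRoot b a := by
  rcases ha with ⟨h0, h⟩ | ⟨h, -⟩
  · exact Or.inr ⟨h0, RootPairing.Base.isPos_of_mem_support h⟩
  · exact Or.inl (by rw [h]; exact one_pos)

variable [P.IsCrystallographic]

/-- An affine weight is a positive affine root. -/
def IsPosWt (lam : affineWeightLattice P) : Prop :=
  ∃ g, IsPosAffineRoot b g ∧ affineRoot P g = lam

variable {b}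

theorem isPosWt_affineRoot {g : ι × ℤ} : IsPosWt b (affineRoot P g) ↔ IsPosAffineRoot b g := by
  refine ⟨?_, fun h => ⟨g, h, rfl⟩⟩
  rintro ⟨g', h, e⟩
  rwa [← affineRoot_injective P e]

theorem isPosWt_neg_affineRoot [P.IsRootSystem] (g : ι × ℤ) :
    IsPosWt b (-affineRoot P g) ↔ ¬ IsPosWt b (affineRoot P g) := by
  have hk : P.root (P.reflectionPerm g.1 g.1) = -P.root g.1 := by simp
  have e : affineRoot P (P.reflectionPerm g.1 g.1, -g.2) = -affineRoot P g := by
    apply Subtype.ext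
    ext <;> simp [affineRoot]
  rw [← e, isPosWt_affineRoot, isPosWt_affineRoot, IsPosAffineRoot, IsPosAffineRoot,
    isPos_or_of_root_eq_neg b hk]
  rcases lt_trichotomy g.2 0 with h | h | h
  · simp [h, h.ne, h.not_gt]
  · simp [h]
  · simp [h, h.ne', h.not_gt]

theorem isPosWt_neg_weylAct [P.IsRootSystem] (w : affineWeylGroup P) (g : ι × ℤ) :
    IsPosWt b (-weylAct P w (affineRoot P g)) ↔ ¬ IsPosWt b (weylAct P w (affineRoot P g)) := by
  obtain ⟨g', h, -⟩ := exists_affineRoot_eq_weylAct P w g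
  rw [← h, isPosWt_neg_affineRoot]

/-- A simple reflection permutes the positive affine roots different from its own. -/
theorem isPosWt_simple [Finite ι] [P.IsRootSystem] [P.IsReduced] {a g : ι × ℤ}
    (ha : a ∈ simpleAffineRoots b) (hg : IsPosAffineRoot b g) (hne : g ≠ a) :
    IsPosWt b (weylAct P (rootReflection P a) (affineRoot P g)) := by
  obtain ⟨i, n⟩ := g
  obtain ⟨k, m⟩ := a
  obtain ⟨p, hp⟩ := (affineRoot P (i, n)).2.1 k
  have hp2 : P.pairing i k = p := hp
  refine ⟨(P.reflectionPerm k i, n - p * m), ?_, ?_⟩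
  · rcases ha with ⟨h0, h⟩ | ⟨h1, j, hj, e⟩
    · simp only at h0 h
      subst h0
      simp only [IsPosAffineRoot, mul_zero, sub_zero]
      refine hg.imp_right fun ⟨hn, hi⟩ => ⟨hn, ?_⟩
      simp only at hn hi
      exact hi.reflectionPerm h fun e => hne (by rw [e, hn])
    · simp only at h1 e
      subst h1
      -- The simple affine root is `(-θ, 1)`. Its reflection sends `(α, n)` to `(α + pθ, n - p)`,
      -- where `-p` is the pairing of `α` with the coroot of `θ`.
      have ek : k = P.reflectionPerm j j := P.root.injective (by simp [e])
      have hc : P.coroot k = -P.coroot j := by simp [ek]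
      have hpj : P.pairing i j = ((-p : ℤ) : ℚ) := by
        rw [Int.cast_neg, ← hp2, ← P.root_coroot_eq_pairing, ← P.root_coroot_eq_pairing, hc,
          map_neg, neg_neg]
      have hroot : P.root (P.reflectionPerm k i) = P.root i + (p : ℚ) • P.root j := by
        rw [P.root_reflectionPerm, P.reflection_apply_root, hp2, e]
        module
      simp only [IsPosAffineRoot, mul_one]
      -- For `α = -θ` the image is `(θ, n - 2)`; here `n ≥ 2`, because `n = 1` is the simple root
      -- itself.
      by_cases hij : P.root i = -P.root j
      · have hik : i = k := P.root.injective (hij.trans e.symm)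
        subst hik
        have hp' : p = 2 := by
          have : (p : ℚ) = 2 := by rw [← hp2, P.pairing_same]
          exact_mod_cast this
        subst hp'
        have hnp : ¬ b.IsPos i := by
          rw [isPos_or_of_root_eq_neg b hij, not_not]
          exact hj.isPos
        have hn : 0 < n := hg.resolve_right fun h => hnp h.2
        have hn1 : n ≠ 1 := fun h => hne (by rw [h])
        rcases (by omega : 2 < n ∨ n = 2) with h | h
        · left
          omega
        · right
          refine ⟨by omega, ?_⟩
          rw [isPos_or_of_root_eq_neg b (i := i) (by simp)]
          exact hnp
      · have hp1 := hj.neg_one_le_pairing hij hpj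
        rcases hg with hn | ⟨hn, hi⟩
        · simp only at hn
          -- In the exceptional case the image is `(α + θ, 0)`, and `α + θ = θ - (-α)` is a sum of
          -- simple roots.
          rcases (by omega : 0 < n - p ∨ (n = 1 ∧ p = 1)) with h | ⟨rfl, rfl⟩
          · exact Or.inl h
          · right
            refine ⟨by simp, isPos_of_root_mem_closure b ?_⟩
            have h := hj (P.reflectionPerm i i)
            rw [hroot]
            simp only [P.root_reflectionPerm, P.reflection_apply_self, sub_neg_eq_add] at h
            simpa [add_comm] using h
        · simp only at hn hi
          have h0 := hj.pairing_nonneg hi hpj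
          rcases (by omega : 0 < n - p ∨ (n - p = 0 ∧ p = 0)) with h | ⟨h, h'⟩
          · exact Or.inl h
          · refine Or.inr ⟨h, ?_⟩
            rw [isPos_iff_heightForm, hroot, h', Int.cast_zero, zero_smul, add_zero,
              ← isPos_iff_heightForm]
            exact hi
  · rw [weylAct_rootReflection P (k, m) (affineRoot P (i, n)) hp]
    apply Subtype.ext
    ext
    · simp [affineRoot, P.root_reflectionPerm, P.reflection_apply, hp2, Int.cast_smul_eq_zsmul]
    · simp [affineRoot]

/-- A simple reflection makes only its own root negative, so a change of sign determines `wγ`. This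
drives the exchange arguments and the degenerate case of `edgeDivisible_succ`. -/
theorem weylAct_simple_not_isPosWt [Finite ι] [P.IsRootSystem] [P.IsReduced] {a g : ι × ℤ}
    (ha : a ∈ simpleAffineRoots b) (w : affineWeylGroup P)
    (h1 : IsPosWt b (weylAct P w (affineRoot P g)))
    (h2 : ¬ IsPosWt b (weylAct P (rootReflection P a * w) (affineRoot P g))) :
    weylAct P w (affineRoot P g) = affineRoot P a ∧
      rootReflection P a = w * rootReflection P g * w⁻¹ := by
  obtain ⟨g', h, hr⟩ := exists_affineRoot_eq_weylAct P w g
  rw [weylAct_mul] at h2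
  rw [← h] at h1 h2 ⊢
  by_cases hne : g' = a
  · subst hne
    exact ⟨rfl, hr⟩
  · exact absurd (isPosWt_simple ha (isPosWt_affineRoot.1 h1) hne) h2

end Positivity

/-! ### Lengths, words and reflections in a group -/

section Length

variable {G : Type*} [Group G] {S : Set G}

theorem length_prod_le {w : List G} (hw : ∀ t ∈ w, t ∈ S) : length S w.prod ≤ w.length :=
  Nat.sInf_le ⟨w, hw, rfl, rfl⟩

theorem exists_reduced_word {x : G} (hx : x ∈ Submonoid.closure S) :
    ∃ w : List G, (∀ t ∈ w, t ∈ S) ∧ w.prod = x ∧ w.length = length S x := by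
  obtain ⟨w, hw, hp⟩ := Submonoid.exists_list_of_mem_closure hx
  exact Nat.sInf_mem (s := {n | ∃ w : List G, (∀ t ∈ w, t ∈ S) ∧ w.prod = x ∧ w.length = n})
    ⟨w.length, w, hw, hp, rfl⟩

theorem bruhatLE.length_le {x y : G} (h : bruhatLE S x y) : length S x ≤ length S y := by
  induction h with
  | refl => rfl
  | tail _ h ih => exact ih.trans h.2.le

theorem bruhatLT.length_lt {x y : G} (h : bruhatLT S x y) : length S x < length S y := by
  rcases Relation.ReflTransGen.cases_head h.1 with e | ⟨c, hc, hc'⟩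
  · exact absurd e h.2
  · exact hc.2.trans_le (bruhatLE.length_le hc')

theorem conj_mem_reflections {r : G} (hr : r ∈ reflections S) (w : G) :
    w * r * w⁻¹ ∈ reflections S := by
  obtain ⟨v, s, hs, rfl⟩ := hr
  exact ⟨w * v, s, hs, by group⟩

theorem mem_reflections {s : G} (hs : s ∈ S) : s ∈ reflections S := ⟨1, s, hs, by group⟩

end Length

/-! ### The exchange condition and the Bruhat order -/

section Exchange

variable {ι V N : Type*} [AddCommGroup V] [Module ℚ V] [AddCommGroup N] [Module ℚ N]
variable {P : RootPairing ι ℚ V N} {b : P.Base}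

theorem rootReflection_mem_simpleReflections (a : simpleAffineRoots b) :
    rootReflection P a.1 ∈ simpleReflections b := ⟨a.1, a.2, rfl⟩

/-- `length` is an infimum of natural numbers, hence `0` on elements that have no word at all.
Length comparisons therefore require this membership, which is available for all of `J(s)`. -/
theorem ev_mem_closure {l : ℕ} (s : Fin l → simpleAffineRoots b) (sub : Fin l → Bool) :
    ev s sub ∈ Submonoid.closure (simpleReflections b) := by
  refine Submonoid.list_prod_mem _ fun t ht => ?_
  obtain ⟨i, rfl⟩ := (List.mem_ofFn' _ _).1 ht
  dsimp only
  split_ifs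
  · exact Submonoid.subset_closure (rootReflection_mem_simpleReflections _)
  · exact one_mem _

theorem mul_simple_mem_closure {x : affineWeylGroup P} (a : simpleAffineRoots b) :
    x * rootReflection P a.1 ∈ Submonoid.closure (simpleReflections b) ↔
      x ∈ Submonoid.closure (simpleReflections b) := by
  have ha := Submonoid.subset_closure (rootReflection_mem_simpleReflections a)
  refine ⟨fun h => ?_, fun h => mul_mem h ha⟩
  simpa only [mul_rootReflection_cancel] using mul_mem h ha

variable [Finite ι] [P.IsRootSystem] [P.IsCrystallographic] [P.IsReduced]

/-- Along the prefixes `u` of the word, `u⁻¹γ` starts positive and ends negative. A letter at which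
the sign changes equals `u⁻¹ s_γ u` for the prefix `u` before it, so multiplying by `s_γ` on the
left deletes that letter. -/
theorem exchange_word {g : ι × ℤ} (hg : IsPosAffineRoot b g) {w : List (affineWeylGroup P)}
    (hw : ∀ t ∈ w, t ∈ simpleReflections b)
    (h : ¬ IsPosWt b (weylAct P w.prod⁻¹ (affineRoot P g))) :
    ∃ w' : List (affineWeylGroup P), (∀ t ∈ w', t ∈ simpleReflections b) ∧
      w'.length < w.length ∧ w'.prod = rootReflection P g * w.prod := by
  induction w using List.reverseRecOn with
  | nil =>
    simp only [List.prod_nil, inv_one, weylAct_one] at h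
    exact absurd (isPosWt_affineRoot.2 hg) h
  | append_singleton w t ih =>
    have hw' : ∀ t ∈ w, t ∈ simpleReflections b := fun t ht => hw t (by simp [ht])
    obtain ⟨a, ha, rfl⟩ := hw t (by simp)
    by_cases h' : IsPosWt b (weylAct P w.prod⁻¹ (affineRoot P g))
    · rw [List.prod_append, List.prod_singleton, mul_inv_rev, rootReflection_inv] at h
      obtain ⟨-, hr⟩ := weylAct_simple_not_isPosWt ha _ h' h
      refine ⟨w, hw', by simp, ?_⟩
      rw [List.prod_append, List.prod_singleton, hr, inv_inv, mul_assoc w.prod⁻¹,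
        mul_inv_cancel_left, rootReflection_cancel_left]
    · obtain ⟨w', h1, h2, h3⟩ := ih hw' h'
      refine ⟨w' ++ [rootReflection P a], ?_, by simpa using h2, ?_⟩
      · intro t ht
        rcases List.mem_append.1 ht with ht | ht
        · exact h1 t ht
        · exact hw t (by simp [List.mem_singleton.1 ht])
      · simp [h3, mul_assoc]

theorem length_rootReflection_mul_lt {g : ι × ℤ} (hg : IsPosAffineRoot b g)
    {x : affineWeylGroup P} (hx : x ∈ Submonoid.closure (simpleReflections b))
    (h : ¬ IsPosWt b (weylAct P x⁻¹ (affineRoot P g))) :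
    length (simpleReflections b) (rootReflection P g * x) < length (simpleReflections b) x := by
  obtain ⟨w, hw, rfl, hl⟩ := exists_reduced_word hx
  obtain ⟨w', h1, h2, h3⟩ := exchange_word hg hw h
  rw [← hl, ← h3]
  exact (length_prod_le h1).trans_lt h2

/-- The strong exchange condition for subexpressions. -/
theorem exchange_ev {g : ι × ℤ} (hg : IsPosAffineRoot b g) {l : ℕ}
    (s : Fin l → simpleAffineRoots b) (sub : Fin l → Bool)
    (h : ¬ IsPosWt b (weylAct P (ev s sub)⁻¹ (affineRoot P g))) :
    ∃ sub', ev s sub' = rootReflection P g * ev s sub := by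
  induction l with
  | zero =>
    simp only [ev, List.ofFn_zero, List.prod_nil, inv_one, weylAct_one] at h
    exact absurd (isPosWt_affineRoot.2 hg) h
  | succ l ih =>
    by_cases h' : IsPosWt b (weylAct P (ev (Fin.init s) (Fin.init sub))⁻¹ (affineRoot P g))
    · rw [ev_succ, mul_inv_rev] at h
      split_ifs at h with hl
      · rw [rootReflection_inv] at h
        obtain ⟨-, hr⟩ := weylAct_simple_not_isPosWt (s (Fin.last l)).2 _ h' h
        -- The sign changes at the last letter, which is replaced with a blank.
        refine ⟨Fin.snoc (Fin.init sub) false, ?_⟩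
        rw [ev_succ, ev_succ s sub, if_pos hl, hr]
        simp only [Fin.init_snoc, Fin.snoc_last, Bool.false_eq_true, if_false, mul_one]
        rw [inv_inv, mul_assoc (ev _ _)⁻¹, mul_inv_cancel_left, rootReflection_cancel_left]
      · rw [inv_one, one_mul] at h
        exact absurd h' h
    · obtain ⟨sub', h1⟩ := ih _ _ h'
      refine ⟨Fin.snoc sub' (sub (Fin.last l)), ?_⟩
      rw [ev_succ, ev_succ s sub]
      simp only [Fin.init_snoc, Fin.snoc_last]
      rw [h1, mul_assoc]

/-- Exchange makes `s_γ x` longer than `x`. The order is defined by right multiplication, so `s_γ`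
is moved to the right as `x⁻¹ s_γ x`. -/
theorem bruhatLT_rootReflection_mul {g : ι × ℤ} (hg : IsPosAffineRoot b g)
    (hr : rootReflection P g ∈ reflections (simpleReflections b)) {x : affineWeylGroup P}
    (hx : rootReflection P g * x ∈ Submonoid.closure (simpleReflections b))
    (h : IsPosWt b (weylAct P x⁻¹ (affineRoot P g))) :
    bruhatLT (simpleReflections b) x (rootReflection P g * x) := by
  have hlt : length (simpleReflections b) x
      < length (simpleReflections b) (rootReflection P g * x) := by
    have := length_rootReflection_mul_lt hg hx (by
      rw [mul_inv_rev, rootReflection_inv, weylAct_mul, weylAct_rootReflection_self, weylAct_neg,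
        isPosWt_neg_weylAct, not_not]
      exact h)
    rwa [rootReflection_cancel_left] at this
  refine ⟨Relation.ReflTransGen.single ⟨⟨x⁻¹ * rootReflection P g * x, ?_, by group⟩, hlt⟩, ?_⟩
  · simpa using conj_mem_reflections hr x⁻¹
  · intro e
    rw [← e] at hlt
    exact hlt.false

theorem bruhatLT_mul_simple_of_isPosWt {x : affineWeylGroup P} (a : simpleAffineRoots b)
    (hx : x ∈ Submonoid.closure (simpleReflections b))
    (h : IsPosWt b (weylAct P x (affineRoot P a.1))) :
    bruhatLT (simpleReflections b) x (x * rootReflection P a.1) := by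
  obtain ⟨g, hg, hr⟩ := exists_affineRoot_eq_weylAct P x a.1
  have e : x * rootReflection P a.1 = rootReflection P g * x := by rw [hr]; group
  rw [← hg] at h
  rw [e]
  refine bruhatLT_rootReflection_mul (isPosWt_affineRoot.1 h) ?_ ?_ ?_
  · rw [hr]
    exact conj_mem_reflections (mem_reflections (rootReflection_mem_simpleReflections a)) _
  · rw [← e, mul_simple_mem_closure]
    exact hx
  · rw [hg, weylAct_inv_weylAct, isPosWt_affineRoot]
    exact simpleAffineRoots_isPos a.2

end Exchange

/-! ### Linear forms in the symmetric algebra -/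

section LinearForms

theorem two_inv_smul_add_self {F M : Type*} [Field F] [AddCommGroup M] [Module F M]
    (h2 : (2 : F) ≠ 0) (x : M) : (2 : F)⁻¹ • (x + x) = x := by
  rw [← two_smul F, smul_smul, inv_mul_cancel₀ h2, one_smul]

theorem exists_basis_apply_eq {F M κ : Type*} [Field F] [AddCommGroup M] [Module F M]
    {v : κ → M} (h : LinearIndependent F v) :
    ∃ (T : Set M) (B : Module.Basis T F M), ∀ k, ∃ i, B i = v k :=
  ⟨_, Module.Basis.extend h.linearIndepOn_id, fun k =>
    ⟨⟨v k, Module.Basis.subset_extend h.linearIndepOn_id ⟨k, rfl⟩⟩,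
      Module.Basis.extend_apply_self h.linearIndepOn_id _⟩⟩

theorem ι_ne_zero {F M : Type*} [Field F] [AddCommGroup M] [Module F M] {v : M} (hv : v ≠ 0) :
    SymmetricAlgebra.ι F M v ≠ 0 := by
  obtain ⟨T, B, hB⟩ := exists_basis_apply_eq (LinearIndependent.of_subsingleton
    (R := F) (v := fun _ : Unit => v) () hv)
  obtain ⟨i, rfl⟩ := hB ()
  intro h
  have e := congrArg (SymmetricAlgebra.equivMvPolynomial B) h
  rw [SymmetricAlgebra.equivMvPolynomial_ι_apply, map_zero] at e
  exact MvPolynomial.X_ne_zero i e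

/-- Extending `v, w` to a basis turns the symmetric algebra into a polynomial ring in which they are
two distinct variables. -/
theorem ι_dvd_of_dvd_ι_mul {F M : Type*} [Field F] [AddCommGroup M] [Module F M] {v w : M}
    (h : LinearIndependent F ![v, w]) {c : SymmetricAlgebra F M}
    (hd : SymmetricAlgebra.ι F M v ∣ SymmetricAlgebra.ι F M w * c) :
    SymmetricAlgebra.ι F M v ∣ c := by
  obtain ⟨T, B, hB⟩ := exists_basis_apply_eq h
  obtain ⟨i, hi⟩ := hB 0
  obtain ⟨j, hj⟩ := hB 1
  have hij : i ≠ j := by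
    rintro rfl
    have h01 : (0 : Fin 2) = 1 := h.injective (hi.symm.trans hj)
    exact absurd h01 (by decide)
  simp only [Matrix.cons_val_zero, Matrix.cons_val_one] at hi hj
  have e := map_dvd (SymmetricAlgebra.equivMvPolynomial B) hd
  rw [map_mul, ← hi, ← hj, SymmetricAlgebra.equivMvPolynomial_ι_apply,
    SymmetricAlgebra.equivMvPolynomial_ι_apply, MvPolynomial.X_dvd_mul_iff,
    MvPolynomial.X_dvd_X] at e
  have e' := map_dvd (SymmetricAlgebra.equivMvPolynomial B).symm (e.resolve_left hij)
  rwa [AlgEquiv.symm_apply_apply, SymmetricAlgebra.equivMvPolynomial_symm_X, hi] at e'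

variable {ι V N : Type*} [AddCommGroup V] [Module ℚ V] [AddCommGroup N] [Module ℚ N]
variable (P : RootPairing ι ℚ V N)

/-- The pairing of affine weights with a coroot. -/
def corootPairing (i : ι) : affineWeightLattice P →+ ℤ :=
  AddMonoidHom.mk' (fun lam => (lam.2.1 i).choose) fun a c => by
    have h : P.toLinearMap (a + c).1.1 (P.coroot i)
        = P.toLinearMap a.1.1 (P.coroot i) + P.toLinearMap c.1.1 (P.coroot i) := by simp
    rw [(a.2.1 i).choose_spec, (c.2.1 i).choose_spec, ((a + c).2.1 i).choose_spec] at h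
    exact_mod_cast h

theorem corootPairing_spec (i : ι) (lam : affineWeightLattice P) :
    P.toLinearMap lam.1.1 (P.coroot i) = corootPairing P i lam := (lam.2.1 i).choose_spec

variable (F : Type*) [Field F]

/-- `bar` as a homomorphism. -/
def barHom : affineWeightLattice P →+ SymAlg P F :=
  AddMonoidHom.mk' (bar P F) fun a c => by
    rw [bar, wt, TensorProduct.tmul_add, map_add]
    rfl

theorem bar_add (a c : affineWeightLattice P) : bar P F (a + c) = bar P F a + bar P F c :=
  (barHom P F).map_add a c

theorem bar_sub (a c : affineWeightLattice P) : bar P F (a - c) = bar P F a - bar P F c :=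
  (barHom P F).map_sub a c

theorem bar_neg (a : affineWeightLattice P) : bar P F (-a) = -bar P F a :=
  (barHom P F).map_neg a

theorem bar_zsmul (k : ℤ) (a : affineWeightLattice P) : bar P F (k • a) = k * bar P F a := by
  rw [← zsmul_eq_mul]
  exact (barHom P F).map_zsmul k a

variable [P.IsCrystallographic]

/-- Pairing with the coroot is integral on the lattice, so it survives base change to `F`; a root is
detected by its value `2` there. -/
theorem wt_affineRoot_ne_zero (h2 : (2 : F) ≠ 0) (g : ι × ℤ) : wt P F (affineRoot P g) ≠ 0 := by
  have h : corootPairing P g.1 (affineRoot P g) = 2 := by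
    have := corootPairing_spec P g.1 (affineRoot P g)
    simp only [affineRoot, P.root_coroot_two] at this
    exact_mod_cast this.symm
  intro h0
  have e := congrArg (TensorProduct.AlgebraTensorModule.rid ℤ F F)
    (congrArg (LinearMap.baseChange F (corootPairing P g.1).toIntLinearMap) h0)
  simp [wt, h] at e
  exact h2 e

theorem bar_affineRoot_ne_zero (h2 : (2 : F) ≠ 0) (g : ι × ℤ) : bar P F (affineRoot P g) ≠ 0 :=
  ι_ne_zero (wt_affineRoot_ne_zero P F h2 g)

theorem bar_mul_simple (w : affineWeylGroup P) (a : ι × ℤ) :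
    bar P F (weylAct P (w * rootReflection P a) (affineRoot P a))
      = -bar P F (weylAct P w (affineRoot P a)) := by
  rw [weylAct_mul, weylAct_rootReflection_self, weylAct_neg, bar_neg]

end LinearForms

/-! ### The modules `X(s)` and the elements of paths -/

section Modules

variable {ι V N : Type*} [AddCommGroup V] [Module ℚ V] [AddCommGroup N] [Module ℚ N]
variable {P : RootPairing ι ℚ V N} {b : P.Base}

theorem ev_init_eq_or {l : ℕ} {s : Fin (l + 1) → simpleAffineRoots b} {x : affineWeylGroup P}
    {σ : Fin (l + 1) → Bool} (h : ev s σ = x) :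
    ev (Fin.init s) (Fin.init σ) = x ∨
      ev (Fin.init s) (Fin.init σ) = x * rootReflection P (s (Fin.last l)).1 := by
  rw [ev_succ] at h
  split_ifs at h
  · right
    rw [← h, mul_rootReflection_cancel]
  · left
    simpa using h

theorem exists_ev_eq {l : ℕ} {s : Fin (l + 1) → simpleAffineRoots b} {x : affineWeylGroup P}
    {τ : Fin l → Bool} (h : ev (Fin.init s) τ = x ∨
      ev (Fin.init s) τ = x * rootReflection P (s (Fin.last l)).1) :
    ∃ σ, Fin.init σ = τ ∧ ev s σ = x := by
  rcases h with h | h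
  · exact ⟨Fin.snoc τ false, Fin.init_snoc _ _, by simp [ev_succ, h]⟩
  · exact ⟨Fin.snoc τ true, Fin.init_snoc _ _, by simp [ev_succ, h, mul_rootReflection_cancel]⟩

variable [P.IsCrystallographic] (F : Type*) [Field F]

variable {F} in
theorem diag_mem_X {l : ℕ} {s : Fin (l + 1) → simpleAffineRoots b}
    {f : (Fin l → Bool) → SymAlg P F} (hf : f ∈ X F (Fin.init s)) : diag F f ∈ X F s :=
  Submodule.mem_sup_left (Submodule.mem_map_of_mem hf)

variable {F} in
theorem cAct_diag_mem_X {l : ℕ} {s : Fin (l + 1) → simpleAffineRoots b}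
    {f : (Fin l → Bool) → SymAlg P F} (hf : f ∈ X F (Fin.init s)) :
    cAct F (affineRoot P (s (Fin.last l)).1) s (diag F f) ∈ X F s :=
  Submodule.mem_sup_right (Submodule.mem_map_of_mem (f := cAct F _ s ∘ₗ diag F) hf)

variable {F} in
theorem exists_of_mem_X {l : ℕ} {s : Fin (l + 1) → simpleAffineRoots b}
    {f : (Fin (l + 1) → Bool) → SymAlg P F} (hf : f ∈ X F s) :
    ∃ f₁ ∈ X F (Fin.init s), ∃ f₂ ∈ X F (Fin.init s),
      f = diag F f₁ + cAct F (affineRoot P (s (Fin.last l)).1) s (diag F f₂) := by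
  obtain ⟨_, ⟨f₁, h₁, rfl⟩, _, ⟨f₂, h₂, rfl⟩, rfl⟩ := Submodule.mem_sup.1 hf
  exact ⟨f₁, h₁, f₂, h₂, rfl⟩

/-- Split `λ` into half of `λ + s_l λ` and half of `k α_l`. The first part is fixed by `s_l`, so its
action commutes with `Δ`. -/
theorem cAct_diag (h2 : (2 : F) ≠ 0) {l : ℕ} (s : Fin (l + 1) → simpleAffineRoots b)
    (lam : affineWeightLattice P) {k : ℤ}
    (hk : weylAct P (rootReflection P (s (Fin.last l)).1) lam
      = lam - k • affineRoot P (s (Fin.last l)).1) (f : (Fin l → Bool) → SymAlg P F) :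
    cAct F lam s (diag F f) =
      (2 : F)⁻¹ • diag F (cAct F (lam + (lam - k • affineRoot P (s (Fin.last l)).1))
        (Fin.init s) f) +
      ((k : F) * 2⁻¹) • cAct F (affineRoot P (s (Fin.last l)).1) s (diag F f) := by
  have hc : algebraMap F (SymAlg P F) 2⁻¹ * 2 = 1 := by
    rw [← map_ofNat (algebraMap F (SymAlg P F)) 2, ← map_mul, inv_mul_cancel₀ h2, map_one]
  funext σ
  simp only [cAct, diag, LinearMap.coe_mk, AddHom.coe_mk, Pi.add_apply, Pi.smul_apply]
  rw [Algebra.smul_def, Algebra.smul_def, map_mul, map_intCast, ev_succ]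
  split_ifs
  · rw [weylAct_mul, hk, weylAct_mul, weylAct_rootReflection_self]
    simp only [weylAct_add, weylAct_sub, weylAct_zsmul, weylAct_neg, bar_add, bar_sub, bar_zsmul,
      bar_neg]
    linear_combination -(bar P F (weylAct P (ev (Fin.init s) (Fin.init σ)) lam) -
      k * bar P F (weylAct P (ev (Fin.init s) (Fin.init σ)) (affineRoot P (s (Fin.last l)).1))) *
      f (Fin.init σ) * hc
  · rw [mul_one]
    simp only [weylAct_add, weylAct_sub, weylAct_zsmul, bar_add, bar_sub, bar_zsmul]
    linear_combination -bar P F (weylAct P (ev (Fin.init s) (Fin.init σ)) lam) *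
      f (Fin.init σ) * hc

theorem cAct_comm {l : ℕ} (s : Fin l → simpleAffineRoots b) (lam mu : affineWeightLattice P)
    (f : (Fin l → Bool) → SymAlg P F) :
    cAct F lam s (cAct F mu s f) = cAct F mu s (cAct F lam s f) := by
  funext σ
  simp only [cAct, LinearMap.coe_mk, AddHom.coe_mk]
  ring

/-- Keeping or blanking the last entry changes only the sign of the weight, which the square does
not see. -/
theorem cAct_cAct_diag {l : ℕ} (s : Fin (l + 1) → simpleAffineRoots b)
    (f : (Fin l → Bool) → SymAlg P F) :
    cAct F (affineRoot P (s (Fin.last l)).1) s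
      (cAct F (affineRoot P (s (Fin.last l)).1) s (diag F f)) =
    diag F (cAct F (affineRoot P (s (Fin.last l)).1) (Fin.init s)
      (cAct F (affineRoot P (s (Fin.last l)).1) (Fin.init s) f)) := by
  funext σ
  simp only [cAct, diag, LinearMap.coe_mk, AddHom.coe_mk]
  rw [ev_succ]
  split_ifs
  · rw [bar_mul_simple]
    ring
  · rw [mul_one]

variable {F} in
/-- `X(s)` is stable under the elements `c^lam` of the structure algebra. -/
theorem cAct_mem_X (h2 : (2 : F) ≠ 0) {l : ℕ} (s : Fin l → simpleAffineRoots b)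
    (lam : affineWeightLattice P) {f : (Fin l → Bool) → SymAlg P F} (hf : f ∈ X F s) :
    cAct F lam s f ∈ X F s := by
  induction l generalizing lam with
  | zero => exact Submodule.mem_top
  | succ l ih =>
    obtain ⟨k, hk⟩ := exists_weylAct_rootReflection P (s (Fin.last l)).1 lam
    obtain ⟨f₁, h₁, f₂, h₂, rfl⟩ := exists_of_mem_X hf
    rw [map_add, cAct_comm, cAct_diag F h2 s lam hk, cAct_diag F h2 s lam hk, map_add,
      LinearMap.map_smul_of_tower, LinearMap.map_smul_of_tower, cAct_cAct_diag]
    refine add_mem (add_mem ?_ ?_) (add_mem ?_ ?_) <;> apply Submodule.smul_of_tower_mem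
    · exact diag_mem_X (ih _ _ h₁)
    · exact cAct_diag_mem_X h₁
    · exact cAct_diag_mem_X (ih _ _ h₂)
    · exact diag_mem_X (ih _ _ (ih _ _ h₂))

theorem pathElement_mem_X (h2 : (2 : F) ≠ 0) {l : ℕ} (s : Fin l → simpleAffineRoots b)
    (p : Fin l → TreeEdge (simpleAffineRoots b)) : pathElement F s p ∈ X F s := by
  induction l with
  | zero => exact Submodule.mem_top
  | succ l ih =>
    rw [pathElement]
    split_ifs
    · exact diag_mem_X (Submodule.smul_of_tower_mem _ _ (add_mem (cAct_mem_X h2 _ _ (ih _ _))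
        (Submodule.smul_mem _ _ (ih _ _))))
    · exact diag_mem_X (ih _ _)

open Classical in
theorem pathElement_succ_apply {l : ℕ} (s : Fin (l + 1) → simpleAffineRoots b)
    (p : Fin (l + 1) → TreeEdge (simpleAffineRoots b)) (σ : Fin (l + 1) → Bool) :
    pathElement F s p σ =
      if (p (Fin.last l)).tilt = .left then
        (2 : F)⁻¹ •
          ((bar P F (weylAct P (ev (Fin.init s) (pathSeq (Fin.init p)))
              (affineRoot P (p (Fin.last l)).root.1)) +
            bar P F (weylAct P (ev (Fin.init s) (Fin.init σ))
              (affineRoot P (p (Fin.last l)).root.1))) *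
            pathElement F (Fin.init s) (Fin.init p) (Fin.init σ))
      else pathElement F (Fin.init s) (Fin.init p) (Fin.init σ) := by
  rw [pathElement]
  split_ifs
  · simp only [cAct, diag, LinearMap.coe_mk, AddHom.coe_mk, Pi.smul_apply, Pi.add_apply,
      smul_eq_mul]
    rw [add_comm, add_mul]
  · rfl

/-- The combination of the elements `b_π`, for the maximal paths `π` of `T(s, x)`. -/
def treeComb {l : ℕ} (s : Fin l → simpleAffineRoots b) (x : affineWeylGroup P)
    (c : (Fin l → TreeEdge (simpleAffineRoots b)) → SymAlg P F) :
    (Fin l → Bool) → SymAlg P F :=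
  fun τ => ((tree s x).maxPaths.map fun p => c p * pathElement F s p τ).sum

theorem treeComb_mem_X (h2 : (2 : F) ≠ 0) {l : ℕ} (s : Fin l → simpleAffineRoots b)
    (x : affineWeylGroup P) (c : (Fin l → TreeEdge (simpleAffineRoots b)) → SymAlg P F) :
    treeComb F s x c ∈ X F s := by
  have : treeComb F s x c = ((tree s x).maxPaths.map fun p => c p • pathElement F s p).sum := by
    funext τ
    rw [treeComb]
    induction (tree s x).maxPaths with
    | nil => rfl
    | cons p L ih => simp [ih]
  rw [this]
  refine list_sum_mem fun f hf => ?_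
  obtain ⟨p, -, rfl⟩ := List.mem_map.1 hf
  exact Submodule.smul_mem _ _ (pathElement_mem_X F h2 s p)

theorem treeComb_sub {l : ℕ} (s : Fin l → simpleAffineRoots b) (x : affineWeylGroup P)
    (c c' : (Fin l → TreeEdge (simpleAffineRoots b)) → SymAlg P F) (τ : Fin l → Bool) :
    treeComb F s x (c - c') τ = treeComb F s x c τ - treeComb F s x c' τ := by
  simp only [treeComb]
  induction (tree s x).maxPaths with
  | nil => simp
  | cons p L ih =>
    rw [List.map_cons, List.map_cons, List.map_cons, List.sum_cons, List.sum_cons, List.sum_cons,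
      ih, Pi.sub_apply]
    ring

theorem treeComb_smul {l : ℕ} (s : Fin l → simpleAffineRoots b) (x : affineWeylGroup P)
    (a : SymAlg P F) (c : (Fin l → TreeEdge (simpleAffineRoots b)) → SymAlg P F)
    (τ : Fin l → Bool) : treeComb F s x (a • c) τ = a * treeComb F s x c τ := by
  simp only [treeComb, Pi.smul_apply, smul_eq_mul, mul_assoc]
  exact List.sum_map_mul_left ..

theorem treeComb_congr {l : ℕ} (s : Fin l → simpleAffineRoots b) (x : affineWeylGroup P)
    {c c' : (Fin l → TreeEdge (simpleAffineRoots b)) → SymAlg P F}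
    (h : ∀ p ∈ (tree s x).maxPaths, c p = c' p) : treeComb F s x c = treeComb F s x c' := by
  funext τ
  rw [treeComb, treeComb]
  congr 1
  exact List.map_congr_left fun p hp => by rw [h p hp]

/-- The restrictions to `I(s)_x` of the elements `b_π`, for the maximal paths `π` of `T(s, x)`,
form a basis of `X(s)^x`. -/
structure IsPathBasis {l : ℕ} (s : Fin l → simpleAffineRoots b) (x : affineWeylGroup P) :
    Prop where
  indep : ∀ c, (∀ τ, ev s τ = x → treeComb F s x c τ = 0) → ∀ p ∈ (tree s x).maxPaths, c p = 0
  span : ∀ f ∈ X F s, ∃ c, ∀ τ, ev s τ = x → f τ = treeComb F s x c τ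

/-- An element of `X(s)` that vanishes at the lower end of an edge is divisible by the label at
the upper end. -/
def EdgeDivisible {l : ℕ} (s : Fin l → simpleAffineRoots b) : Prop :=
  ∀ g, IsPosAffineRoot b g → rootReflection P g ∈ reflections (simpleReflections b) →
    ∀ y : affineWeylGroup P, IsPosWt b (weylAct P y⁻¹ (affineRoot P g)) →
      ∀ f ∈ X F s, (∀ τ, ev s τ = y → f τ = 0) →
        ∃ k ∈ X F s, ∀ τ, ev s τ = rootReflection P g * y → f τ = bar P F (affineRoot P g) * k τ

end Modules

/-! ### Recursion for the trees and the inductive step for bases -/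

section Trees

variable {ι V N : Type*} [AddCommGroup V] [Module ℚ V] [AddCommGroup N] [Module ℚ N]
variable {P : RootPairing ι ℚ V N} {b : P.Base}

/-- The path `p` followed by the edge `e`. -/
abbrev addEdge {A : Type*} {l : ℕ} (e : TreeEdge A) (p : Fin l → TreeEdge A) :
    Fin (l + 1) → TreeEdge A := Fin.snoc (α := fun _ => TreeEdge A) p e

theorem maxPaths_eq_nil {l : ℕ} {s : Fin l → simpleAffineRoots b} {x : affineWeylGroup P}
    (h : ¬ (subseqsAt s x).Nonempty) : (tree s x).maxPaths = [] :=
  List.eq_nil_iff_forall_not_mem.2 fun p hp => h ⟨_, pathSeq_mem s x p hp⟩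

theorem isPathBasis_zero [P.IsCrystallographic] (F : Type*) [Field F]
    (s : Fin 0 → simpleAffineRoots b) (x : affineWeylGroup P) :
    IsPathBasis F s x := by
  by_cases hx : x = 1
  · have hL : (tree s x).maxPaths = [Fin.elim0] := by
      rw [tree, if_pos hx]
      rfl
    have hc : ∀ c τ, treeComb F s x c τ = c Fin.elim0 := fun c τ => by
      simp [treeComb, hL, pathElement]
    refine ⟨fun c h p hp => ?_, fun f _ => ⟨fun _ => f Fin.elim0, fun τ _ => ?_⟩⟩
    · rw [hL, List.mem_singleton] at hp
      rw [hp, ← hc c Fin.elim0]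
      exact h _ (by simp [ev, hx])
    · rw [hc, Subsingleton.elim τ Fin.elim0]
  · have hn : ∀ τ, ev s τ ≠ x := fun τ h => hx (by simpa [ev] using h.symm)
    refine ⟨fun c _ p hp => ?_, fun f _ => ⟨0, fun τ h => absurd h (hn τ)⟩⟩
    exact absurd (pathSeq_mem s x p hp) (hn _)

theorem treeComb_succ [P.IsCrystallographic] (F : Type*) [Field F]
    {l : ℕ} (s : Fin (l + 1) → simpleAffineRoots b)
    {y z x : affineWeylGroup P} {c₁ c₂ : SignType} {t : Tilt} (ht : t ≠ .left)
    (hL : (tree s x).maxPaths =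
      (tree (Fin.init s) y).maxPaths.map (addEdge ⟨c₁, s (Fin.last l), t⟩) ++
      (tree (Fin.init s) z).maxPaths.map (addEdge ⟨c₂, s (Fin.last l), .left⟩))
    (c : (Fin (l + 1) → TreeEdge (simpleAffineRoots b)) → SymAlg P F) (σ : Fin (l + 1) → Bool) :
    treeComb F s x c σ =
      treeComb F (Fin.init s) y (fun p => c (addEdge ⟨c₁, s (Fin.last l), t⟩ p)) (Fin.init σ) +
      (2 : F)⁻¹ • ((bar P F (weylAct P z (affineRoot P (s (Fin.last l)).1)) +
          bar P F (weylAct P (ev (Fin.init s) (Fin.init σ)) (affineRoot P (s (Fin.last l)).1))) *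
        treeComb F (Fin.init s) z (fun p => c (addEdge ⟨c₂, s (Fin.last l), .left⟩ p))
          (Fin.init σ)) := by
  rw [treeComb, hL, List.map_append, List.sum_append, List.map_map, List.map_map, treeComb,
    treeComb]
  congr 1
  · refine congrArg _ (List.map_congr_left fun p _ => ?_)
    simp only [Function.comp_apply]
    rw [pathElement_succ_apply]
    simp [addEdge, ht]
  · rw [← smul_mul_assoc, ← List.sum_map_mul_left]
    refine congrArg _ (List.map_congr_left fun p hp => ?_)
    have hp' : ev (Fin.init s) (pathSeq p) = z := pathSeq_mem _ _ p hp
    simp only [Function.comp_apply]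
    rw [pathElement_succ_apply]
    simp only [addEdge, Fin.snoc_last, if_true, Fin.init_snoc, hp']
    rw [smul_mul_assoc, mul_smul_comm]
    congr 1
    ring

variable [Finite ι] [P.IsRootSystem] [P.IsCrystallographic] [P.IsReduced]

/-- Exchange turns a subexpression for the upper element into one for the lower. Hence a lone
subtree always belongs to the lower element. -/
theorem nonempty_of_nonempty_mul_simple {l : ℕ} {s : Fin l → simpleAffineRoots b}
    {y : affineWeylGroup P} {a : ι × ℤ} (ha : IsPosAffineRoot b a)
    (h : IsPosWt b (weylAct P y (affineRoot P a)))
    (hz : (subseqsAt s (y * rootReflection P a)).Nonempty) : (subseqsAt s y).Nonempty := by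
  obtain ⟨τ, hτ⟩ := hz
  change ev s τ = _ at hτ
  obtain ⟨g, hg, hr⟩ := exists_affineRoot_eq_weylAct P y a
  rw [← hg, isPosWt_affineRoot] at h
  obtain ⟨τ', h'⟩ := exchange_ev h s τ (by
    rw [hτ, hg, mul_inv_rev, rootReflection_inv, weylAct_mul, weylAct_inv_weylAct,
      weylAct_rootReflection_self, isPosWt_neg_affineRoot, not_not, isPosWt_affineRoot]
    exact ha)
  refine ⟨τ', ?_⟩
  change ev s τ' = y
  rw [h', hτ, hr, ← mul_assoc, inv_mul_cancel_right, mul_rootReflection_cancel]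

/-- Every shape of tree is brought into the form with two subtrees, an empty subtree contributing
the empty list. This spares later inductions the case distinction; of the tilts and colors it keeps
only what they use. -/
theorem exists_maxPaths_eq {l : ℕ} (s : Fin (l + 1) → simpleAffineRoots b)
    {y x : affineWeylGroup P}
    (h : IsPosWt b (weylAct P y (affineRoot P (s (Fin.last l)).1)))
    (hx : x = y ∨ x = y * rootReflection P (s (Fin.last l)).1) :
    ∃ (c₁ c₂ : SignType) (t : Tilt), t ≠ .left ∧ (c₁ = 0 ↔ x = y) ∧ (c₂ = 0 ↔ x ≠ y) ∧
      (tree s x).maxPaths =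
        (tree (Fin.init s) y).maxPaths.map (addEdge ⟨c₁, s (Fin.last l), t⟩) ++
        (tree (Fin.init s) (y * rootReflection P (s (Fin.last l)).1)).maxPaths.map
          (addEdge ⟨c₂, s (Fin.last l), .left⟩) := by
  set a := s (Fin.last l) with ha
  set z := y * rootReflection P a.1 with hz
  have hzy : z * rootReflection P a.1 = y := mul_rootReflection_cancel P y a.1
  have hne : z ≠ y := by
    intro e
    have h1 : weylAct P z (affineRoot P a.1) = -weylAct P y (affineRoot P a.1) := by
      rw [hz, weylAct_mul, weylAct_rootReflection_self, weylAct_neg]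
    have h2 := (isPosWt_neg_weylAct (b := b) y a.1).1 (by rwa [← h1, e])
    exact h2 h
  have hdown := nonempty_of_nonempty_mul_simple (s := Fin.init s) (simpleAffineRoots_isPos a.2) h
  rw [← hz] at hdown
  by_cases hy : (subseqsAt (Fin.init s) y).Nonempty
  · have hyc : y ∈ Submonoid.closure (simpleReflections b) := by
      obtain ⟨τ, hτ⟩ := hy
      change ev _ τ = y at hτ
      rw [← hτ]
      exact ev_mem_closure _ _
    have hlt : bruhatLT (simpleReflections b) y z := bruhatLT_mul_simple_of_isPosWt a hyc h
    have hnlt : ¬ bruhatLT (simpleReflections b) z y := fun h' =>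
      lt_asymm hlt.length_lt h'.length_lt
    by_cases hzn : (subseqsAt (Fin.init s) z).Nonempty
    · rcases hx with rfl | rfl
      · refine ⟨0, -1, .right, by simp, by simp, by simp, ?_⟩
        rw [tree]
        simp only [← ha, ← hz, hy, hzn, hlt, and_self, if_true]
        rfl
      · refine ⟨1, 0, .right, by simp, by simp [hne], by simp [hne], ?_⟩
        rw [tree]
        simp only [← ha, hzy, hy, hzn, hnlt, and_self, if_true, if_false]
        rfl
    · simp only [maxPaths_eq_nil hzn, List.map_nil, List.append_nil]
      rcases hx with rfl | rfl
      -- No path carries the second color here, so it is chosen just to meet the condition on `c₂`.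
      · refine ⟨0, -1, .vertical, by simp, by simp, by simp, ?_⟩
        rw [tree]
        simp only [← ha, ← hz, hy, hzn, hlt, and_false, or_false, if_true, if_false]
        rfl
      · refine ⟨1, 0, .vertical, by simp, by simp [hne], by simp [hne], ?_⟩
        rw [tree]
        simp only [← ha, hzy, hy, hzn, hnlt, false_and, or_true, if_true, if_false]
        rfl
  · have hzn : ¬ (subseqsAt (Fin.init s) z).Nonempty := fun h' => hy (hdown h')
    rw [maxPaths_eq_nil hy, maxPaths_eq_nil hzn]
    rcases hx with rfl | rfl
    · refine ⟨0, -1, .vertical, by simp, by simp, by simp, ?_⟩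
      rw [tree]
      simp only [← ha, ← hz, hy, hzn, and_false, or_false, if_false]
      rfl
    · refine ⟨1, 0, .vertical, by simp, by simp [hne], by simp [hne], ?_⟩
      rw [tree]
      simp only [← ha, hzy, hy, hzn, and_false, or_false, if_false]
      rfl

omit [Finite ι] [P.IsReduced] in
theorem exists_lower {a : ι × ℤ} (x : affineWeylGroup P) :
    ∃ y, IsPosWt b (weylAct P y (affineRoot P a)) ∧ (x = y ∨ x = y * rootReflection P a) := by
  by_cases h : IsPosWt b (weylAct P x (affineRoot P a))
  · exact ⟨x, h, Or.inl rfl⟩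
  · refine ⟨x * rootReflection P a, ?_, Or.inr (mul_rootReflection_cancel P x a).symm⟩
    rw [weylAct_mul, weylAct_rootReflection_self, weylAct_neg, isPosWt_neg_weylAct]
    exact h

variable (F : Type*) [Field F]

/-- The triangular step. Coefficients over `y` are determined first; what remains vanishes over `y`,
so over `z` it is `y(α_l)` times an element of `X(s')`, which the basis over `z` expands. -/
theorem isPathBasis_succ (h2 : (2 : F) ≠ 0) {l : ℕ} (s : Fin (l + 1) → simpleAffineRoots b)
    (hA : ∀ x, IsPathBasis F (Fin.init s) x) (hB : EdgeDivisible F (Fin.init s))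
    (x : affineWeylGroup P) : IsPathBasis F s x := by
  obtain ⟨y, hy, hx⟩ := exists_lower (b := b) (a := (s (Fin.last l)).1) x
  obtain ⟨c₁, c₂, t, ht, -, -, hL⟩ := exists_maxPaths_eq s hy hx
  have hcomb := treeComb_succ F s ht hL
  set a := (s (Fin.last l)).1 with ha
  set z := y * rootReflection P a with hz
  have hza : bar P F (weylAct P z (affineRoot P a)) = -bar P F (weylAct P y (affineRoot P a)) :=
    bar_mul_simple P F y a
  have hlow : ∀ c σ, ev (Fin.init s) (Fin.init σ) = y → treeComb F s x c σ =
      treeComb F (Fin.init s) y (fun p => c (addEdge ⟨c₁, s (Fin.last l), t⟩ p))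
        (Fin.init σ) := by
    intro c σ hσ
    rw [hcomb, hσ, hza, neg_add_cancel, zero_mul, smul_zero, add_zero]
  have hhigh : ∀ c σ, ev (Fin.init s) (Fin.init σ) = z → treeComb F s x c σ =
      treeComb F (Fin.init s) y (fun p => c (addEdge ⟨c₁, s (Fin.last l), t⟩ p)) (Fin.init σ) +
      bar P F (weylAct P z (affineRoot P a)) *
        treeComb F (Fin.init s) z (fun p => c (addEdge ⟨c₂, s (Fin.last l), .left⟩ p))
          (Fin.init σ) := by
    intro c σ hσ
    rw [hcomb, hσ, add_mul, two_inv_smul_add_self h2]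
  have hcov : ∀ τ, ev (Fin.init s) τ = y ∨ ev (Fin.init s) τ = z →
      ∃ σ, Fin.init σ = τ ∧ ev s σ = x := by
    intro τ hτ
    refine exists_ev_eq ?_
    rcases hx with rfl | rfl
    · exact hτ
    · rw [mul_rootReflection_cancel]
      exact hτ.symm
  have hcov' : ∀ σ, ev s σ = x → ev (Fin.init s) (Fin.init σ) = y ∨
      ev (Fin.init s) (Fin.init σ) = z := by
    intro σ hσ
    have h := ev_init_eq_or hσ
    rcases hx with rfl | rfl
    · exact h
    · rw [mul_rootReflection_cancel] at h
      exact h.symm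
  obtain ⟨g, hg, hr⟩ := exists_affineRoot_eq_weylAct P y a
  have hgy : rootReflection P g * y = z := by rw [hr, inv_mul_cancel_right]
  constructor
  · intro c hc
    have h1 := (hA y).indep (fun p => c (addEdge ⟨c₁, s (Fin.last l), t⟩ p)) fun τ hτ => by
      obtain ⟨σ, rfl, hσ⟩ := hcov τ (Or.inl hτ)
      rw [← hlow c σ hτ, hc σ hσ]
    have h1' := treeComb_congr F (Fin.init s) y
      (c := fun p => c (addEdge ⟨c₁, s (Fin.last l), t⟩ p)) (c' := 0) h1
    have h2' := (hA z).indep (fun p => c (addEdge ⟨c₂, s (Fin.last l), .left⟩ p)) fun τ hτ => by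
      obtain ⟨σ, rfl, hσ⟩ := hcov τ (Or.inr hτ)
      have h3 := hhigh c σ hτ
      rw [hc σ hσ, h1', hza, ← hg] at h3
      have h0 : treeComb F (Fin.init s) y 0 (Fin.init σ) = 0 := by simp [treeComb]
      rw [h0, zero_add, eq_comm, mul_eq_zero, neg_eq_zero] at h3
      exact h3.resolve_left (bar_affineRoot_ne_zero P F h2 g)
    intro p hp
    rw [hL, List.mem_append, List.mem_map, List.mem_map] at hp
    rcases hp with ⟨q, hq, rfl⟩ | ⟨q, hq, rfl⟩
    · exact h1 q hq
    · exact h2' q hq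
  · intro f hf
    obtain ⟨f₁, hf₁, f₂, hf₂, rfl⟩ := exists_of_mem_X hf
    -- On `I(s)_x` the operator `c^a` is the scalar `x(a)`, so `f` is there the pullback of `h`.
    set h := f₁ + bar P F (weylAct P x (affineRoot P a)) • f₂ with hh
    have hhX : h ∈ X F (Fin.init s) := add_mem hf₁ (Submodule.smul_mem _ _ hf₂)
    have hfh : ∀ σ, ev s σ = x → (diag F f₁ + cAct F (affineRoot P a) s (diag F f₂)) σ
        = h (Fin.init σ) := by
      rintro σ rfl
      rfl
    obtain ⟨d₁, hd₁⟩ := (hA y).span h hhX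
    obtain ⟨k, hkX, hk⟩ := hB g (isPosWt_affineRoot.1 (by rwa [hg]))
      (by rw [hr]; exact conj_mem_reflections (mem_reflections
            (rootReflection_mem_simpleReflections (s (Fin.last l)))) y) y
      (by rw [hg, weylAct_inv_weylAct]
          exact isPosWt_affineRoot.2 (simpleAffineRoots_isPos (s (Fin.last l)).2))
      (h - treeComb F (Fin.init s) y d₁) (sub_mem hhX (treeComb_mem_X F h2 _ _ _))
      (fun τ hτ => by rw [Pi.sub_apply, hd₁ τ hτ, sub_self])
    obtain ⟨d₂, hd₂⟩ := (hA z).span k hkX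
    classical
    -- The sign arises because the edge from `y` to `z` has label `y(a)`, whereas the left tilted
    -- elements carry the factor `z(a) = -y(a)`.
    refine ⟨fun p => if (p (Fin.last l)).tilt = .left then -d₂ (Fin.init p) else d₁ (Fin.init p),
      fun σ hσ => ?_⟩
    rw [hfh σ hσ]
    rcases hcov' σ hσ with h' | h'
    · rw [hlow _ σ h', hd₁ _ h']
      simp [addEdge, ht]
    · rw [hhigh _ σ h']
      have h3 := hk _ (h'.trans hgy.symm)
      rw [Pi.sub_apply, hd₂ _ h', hg] at h3
      have h4 : treeComb F (Fin.init s) z (fun p => -d₂ p) (Fin.init σ)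
          = -treeComb F (Fin.init s) z d₂ (Fin.init σ) := by
        have := treeComb_smul F (Fin.init s) z (-1) d₂ (Fin.init σ)
        rw [neg_one_mul] at this
        rw [← this]
        congr 1
        funext p
        simp
      simp only [addEdge, Fin.snoc_last, Fin.init_snoc, ht, if_true, if_false]
      rw [h4, hza]
      linear_combination h3

end Trees

/-! ### Divisibility along edges -/

section Divisibility

variable {ι V N : Type*} [AddCommGroup V] [Module ℚ V] [AddCommGroup N] [Module ℚ N]
variable {P : RootPairing ι ℚ V N} {b : P.Base}

theorem evSet_init_subset {l : ℕ} (s : Fin (l + 1) → simpleAffineRoots b) :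
    evSet (Fin.init s) ⊆ evSet s := by
  rintro _ ⟨τ, rfl⟩
  obtain ⟨σ, -, h⟩ := exists_ev_eq (s := s) (Or.inl (Eq.refl (ev (Fin.init s) τ)))
  exact ⟨σ, h⟩

theorem mul_simple_mem_evSet {l : ℕ} (s : Fin (l + 1) → simpleAffineRoots b)
    {x : affineWeylGroup P} (hx : x ∈ evSet (Fin.init s)) :
    x * rootReflection P (s (Fin.last l)).1 ∈ evSet s := by
  obtain ⟨τ, hτ⟩ := hx
  obtain ⟨σ, -, h⟩ := exists_ev_eq (s := s) (τ := τ)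
    (x := x * rootReflection P (s (Fin.last l)).1)
    (Or.inr (by rw [mul_rootReflection_cancel, hτ]))
  exact ⟨σ, h⟩

variable [P.IsCrystallographic]

theorem GKM.mono {F : Type*} [Field F] {I J : Set (affineWeylGroup P)} (h : GKM b F J)
    (hIJ : I ⊆ J) : GKM b F I :=
  fun E E' hne h1 h2 h3 h4 => h E E' hne (hIJ h1) (hIJ h2) (hIJ h3) (hIJ h4)

variable [Finite ι] [P.IsRootSystem] [P.IsReduced] {F : Type*} [Field F]

theorem rootReflection_mul_mem_evSet {g : ι × ℤ} (hg : IsPosAffineRoot b g) {l : ℕ}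
    {s : Fin l → simpleAffineRoots b} {x : affineWeylGroup P} (hx : x ∈ evSet s)
    (h : ¬ IsPosWt b (weylAct P x⁻¹ (affineRoot P g))) : rootReflection P g * x ∈ evSet s := by
  obtain ⟨τ, rfl⟩ := hx
  obtain ⟨τ', h'⟩ := exchange_ev hg s τ h
  exact ⟨τ', h'⟩

omit [Finite ι] [P.IsReduced] in
theorem not_isPosWt_inv_rootReflection_mul {g : ι × ℤ} {y : affineWeylGroup P}
    (h : IsPosWt b (weylAct P y⁻¹ (affineRoot P g))) :
    ¬ IsPosWt b (weylAct P (rootReflection P g * y)⁻¹ (affineRoot P g)) := by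
  rw [mul_inv_rev, rootReflection_inv, weylAct_mul, weylAct_rootReflection_self, weylAct_neg,
    isPosWt_neg_weylAct, not_not]
  exact h

/-- The labels of two edges of the moment graph with the same target do not divide each other. -/
theorem bar_dvd_of_dvd_bar_mul (h2 : (2 : F) ≠ 0) {I : Set (affineWeylGroup P)}
    (hGKM : GKM b F I) {x : affineWeylGroup P} (hx : x ∈ I)
    (hxc : x ∈ Submonoid.closure (simpleReflections b)) {g g' : ι × ℤ} (hne : g ≠ g')
    (hg : IsPosAffineRoot b g) (hg' : IsPosAffineRoot b g')
    (hr : rootReflection P g ∈ reflections (simpleReflections b))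
    (hr' : rootReflection P g' ∈ reflections (simpleReflections b))
    (hI : rootReflection P g * x ∈ I) (hI' : rootReflection P g' * x ∈ I)
    (hpos : ¬ IsPosWt b (weylAct P x⁻¹ (affineRoot P g)))
    (hpos' : ¬ IsPosWt b (weylAct P x⁻¹ (affineRoot P g')))
    {c : SymAlg P F} (hd : bar P F (affineRoot P g) ∣ bar P F (affineRoot P g') * c) :
    bar P F (affineRoot P g) ∣ c := by
  have edge : ∀ h : ι × ℤ, IsPosAffineRoot b h →
      rootReflection P h ∈ reflections (simpleReflections b) →
      ¬ IsPosWt b (weylAct P x⁻¹ (affineRoot P h)) →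
      ∃ E : Edge b, E.src = rootReflection P h * x ∧ E.tgt = x ∧ E.root = h := by
    intro h hh hrh hn
    have hlt := bruhatLT_rootReflection_mul (x := rootReflection P h * x) hh hrh
      (by rwa [rootReflection_cancel_left]) (by
        rw [mul_inv_rev, rootReflection_inv, weylAct_mul, weylAct_rootReflection_self,
          weylAct_neg, isPosWt_neg_weylAct]
        exact hn)
    exact ⟨⟨_, _, h, hh, hlt, rfl⟩, rfl, rootReflection_cancel_left P x h, rfl⟩
  obtain ⟨E, e1, e2, e3⟩ := edge g hg hr hpos
  obtain ⟨E', e1', e2', e3'⟩ := edge g' hg' hr' hpos'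
  refine ι_dvd_of_dvd_ι_mul ((LinearIndependent.pair_iff' (wt_affineRoot_ne_zero P F h2 g)).2
    fun k hk => ?_) hd
  refine hGKM E E' (fun h => hne (by rw [← e3, ← e3', h])) (by rwa [e1]) (by rwa [e2])
    (by rwa [e1']) (by rwa [e2']) (Or.inr (Or.inr (Or.inr (by rw [e2, e2'])))) k ?_
  rw [e3, e3', hk]

/-- The edges from `y` to `u` and from `y s_l` to `v` give separate quotients `k₁` and `k₃`. The
edge from `u` to `v`, with label `γ' = u(α_l)`, compares them: over `v`, `f - γ k₁ = γ' k₂`, hence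
`γ' k₂ = γ (k₃ - k₁)`. So `k₂ = γ K` over `v` with `K` in `X(s')`. The operator `(γ' - c^{α_l})/2`
is `0` over `u` and `γ'` over `v`; applied to `K`, it corrects `k₁` over `v` without changing it
over `u`. -/
theorem exists_eq_bar_mul_of_pair (h2 : (2 : F) ≠ 0) {l : ℕ}
    (s : Fin (l + 1) → simpleAffineRoots b) (hGKM : GKM b F (evSet s))
    (hA : ∀ x, IsPathBasis F (Fin.init s) x) (hB : EdgeDivisible F (Fin.init s))
    {g : ι × ℤ} (hg : IsPosAffineRoot b g)
    (hr : rootReflection P g ∈ reflections (simpleReflections b)) {y u v : affineWeylGroup P}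
    (hu : rootReflection P g * y = u) (hv : v = u * rootReflection P (s (Fin.last l)).1)
    (hpos : IsPosWt b (weylAct P u (affineRoot P (s (Fin.last l)).1)))
    (hy : IsPosWt b (weylAct P y⁻¹ (affineRoot P g)))
    (hya : IsPosWt b
      (weylAct P (y * rootReflection P (s (Fin.last l)).1)⁻¹ (affineRoot P g)))
    {f : (Fin l → Bool) → SymAlg P F} (hf : f ∈ X F (Fin.init s))
    (h0 : ∀ τ, ev (Fin.init s) τ = y → f τ = 0)
    (h0a : ∀ τ, ev (Fin.init s) τ = y * rootReflection P (s (Fin.last l)).1 → f τ = 0) :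
    ∃ k ∈ X F (Fin.init s), ∀ τ, (ev (Fin.init s) τ = u ∨ ev (Fin.init s) τ = v) →
      f τ = bar P F (affineRoot P g) * k τ := by
  have hsimple := simpleAffineRoots_isPos (s (Fin.last l)).2
  have hsr := rootReflection_mem_simpleReflections (s (Fin.last l))
  have hev := evSet_init_subset s
  have hmul := fun x hx => mul_simple_mem_evSet s (x := x) hx
  set a := (s (Fin.last l)).1 with ha
  have hyv : rootReflection P g * (y * rootReflection P a) = v := by rw [hv, ← hu, mul_assoc]
  have hva : v * rootReflection P a = u := by rw [hv, mul_rootReflection_cancel]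
  obtain ⟨g', hg', hrg'⟩ := exists_affineRoot_eq_weylAct P u a
  have hr' : rootReflection P g' ∈ reflections (simpleReflections b) := by
    rw [hrg']
    exact conj_mem_reflections (mem_reflections hsr) u
  have hpos' : IsPosAffineRoot b g' := isPosWt_affineRoot.1 (by rwa [hg'])
  have huv : rootReflection P g' * u = v := by rw [hrg', inv_mul_cancel_right, hv]
  have hug' : IsPosWt b (weylAct P u⁻¹ (affineRoot P g')) := by
    rw [hg', weylAct_inv_weylAct, isPosWt_affineRoot]
    exact hsimple
  obtain ⟨k₁, hk₁X, hk₁⟩ := hB g hg hr y hy f hf h0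
  obtain ⟨k₃, hk₃X, hk₃⟩ := hB g hg hr _ hya f hf h0a
  rw [hu] at hk₁
  rw [hyv] at hk₃
  obtain ⟨k₂, hk₂X, hk₂⟩ := hB g' hpos' hr' u hug' (f - bar P F (affineRoot P g) • k₁)
    (sub_mem hf (Submodule.smul_mem _ _ hk₁X)) fun τ hτ => by
      rw [Pi.sub_apply, Pi.smul_apply, hk₁ τ hτ, smul_eq_mul, sub_self]
  rw [huv] at hk₂
  by_cases hne : v ∈ evSet (Fin.init s)
  swap
  · refine ⟨k₁, hk₁X, fun τ hτ => hk₁ τ (hτ.resolve_right fun h => hne ⟨τ, h⟩)⟩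
  have hn1 := not_isPosWt_inv_rootReflection_mul hya
  rw [hyv] at hn1
  have hn2 := not_isPosWt_inv_rootReflection_mul hug'
  rw [huv] at hn2
  -- `u⁻¹` makes `γ` negative and `γ'` positive.
  have hgg' : g ≠ g' := by
    rintro rfl
    have := not_isPosWt_inv_rootReflection_mul hy
    rw [hu] at this
    exact this hug'
  have hvc : v ∈ Submonoid.closure (simpleReflections b) := by
    obtain ⟨τ, hτ⟩ := hne
    rw [← hτ]
    exact ev_mem_closure _ τ
  have hdvd : ∀ c : SymAlg P F, bar P F (affineRoot P g) ∣ bar P F (affineRoot P g') * c →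
      bar P F (affineRoot P g) ∣ c := fun c =>
    bar_dvd_of_dvd_bar_mul h2 hGKM (hev hne) hvc hgg' hg hpos' hr hr'
      (hev (rootReflection_mul_mem_evSet hg hne hn1))
      (hev (rootReflection_mul_mem_evSet hpos' hne hn2)) hn1 hn2
  obtain ⟨c₂, hc₂⟩ := (hA v).span k₂ hk₂X
  obtain ⟨c₃, hc₃⟩ := (hA v).span (k₃ - k₁) (sub_mem hk₃X hk₁X)
  -- Independence over `v` reduces an identity of functions to identities of coefficients in `S`,
  -- where coprimality of `γ` and `γ'` applies.
  have hcc := (hA v).indep (bar P F (affineRoot P g') • c₂ - bar P F (affineRoot P g) • c₃)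
    fun τ hτ => by
      rw [treeComb_sub, treeComb_smul, treeComb_smul, ← hc₂ τ hτ, ← hc₃ τ hτ, ← hk₂ τ hτ,
        Pi.sub_apply, Pi.sub_apply, hk₃ τ hτ, Pi.smul_apply, smul_eq_mul]
      ring
  have hc₄ : ∀ p, ∃ d, p ∈ (tree (Fin.init s) v).maxPaths →
      c₂ p = bar P F (affineRoot P g) * d := by
    intro p
    by_cases hp : p ∈ (tree (Fin.init s) v).maxPaths
    · obtain ⟨d, hd⟩ := hdvd (c₂ p) ⟨c₃ p, sub_eq_zero.1 (hcc p hp)⟩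
      exact ⟨d, fun _ => hd⟩
    · exact ⟨0, fun h => absurd h hp⟩
  choose c₄ hc₄ using hc₄
  have hk₂' : ∀ τ, ev (Fin.init s) τ = v →
      k₂ τ = bar P F (affineRoot P g) * treeComb F (Fin.init s) v c₄ τ := fun τ hτ => by
    rw [hc₂ τ hτ, treeComb_congr F (Fin.init s) v (c' := bar P F (affineRoot P g) • c₄) hc₄,
      treeComb_smul]
  have hKX := treeComb_mem_X F h2 (Fin.init s) v c₄
  set K := treeComb F (Fin.init s) v c₄ with hK
  refine ⟨k₁ + (2 : F)⁻¹ • (bar P F (affineRoot P g') • K - cAct F (affineRoot P a) _ K),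
    add_mem hk₁X (Submodule.smul_of_tower_mem _ _ (sub_mem (Submodule.smul_mem _ _ hKX)
      (cAct_mem_X h2 _ _ hKX))), ?_⟩
  rintro τ (hτ | hτ)
  · have : cAct F (affineRoot P a) (Fin.init s) K τ = bar P F (affineRoot P g') * K τ := by
      rw [hg', ← hτ]
      rfl
    rw [Pi.add_apply, Pi.smul_apply, Pi.sub_apply, this, Pi.smul_apply, smul_eq_mul, sub_self,
      smul_zero, add_zero]
    exact hk₁ τ hτ
  · have : cAct F (affineRoot P a) (Fin.init s) K τ = -(bar P F (affineRoot P g') * K τ) := by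
      rw [hg', ← neg_mul, ← bar_mul_simple, ← hv, ← hτ]
      rfl
    rw [Pi.add_apply, Pi.smul_apply, Pi.sub_apply, this, Pi.smul_apply, smul_eq_mul, sub_neg_eq_add,
      two_inv_smul_add_self h2]
    have h3 := hk₂ τ hτ
    rw [hk₂' τ hτ, Pi.sub_apply, Pi.smul_apply, smul_eq_mul] at h3
    linear_combination h3

-- The only vertex is the identity, which is never the upper end of an edge.
omit [Finite ι] [P.IsReduced] in
theorem edgeDivisible_zero (s : Fin 0 → simpleAffineRoots b) : EdgeDivisible F s := by
  intro g hg _ y hy f _ h0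
  refine ⟨0, zero_mem _, fun τ hτ => ?_⟩
  have h1 : ev s τ = 1 := by simp [ev]
  have hn := not_isPosWt_inv_rootReflection_mul hy
  rw [← hτ, h1, inv_one, weylAct_one, isPosWt_affineRoot] at hn
  exact absurd hg hn

/-- Over `w` an element of `X(s)` is `f₁ + w(α_l) f₂`, and `w = y` and `w = s_γ y` give scalars
differing by a multiple of `γ`. So only `k₀ = f₁ + y(α_l) f₂` has to be divided. It vanishes over
both `y` and `y s_l`, and a common quotient over `s_γ y` and `s_γ y s_l` is required, unless `s_γ y
= y s_l`. -/
theorem edgeDivisible_succ (h2 : (2 : F) ≠ 0) {l : ℕ}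
    (s : Fin (l + 1) → simpleAffineRoots b) (hGKM : GKM b F (evSet s))
    (hA : ∀ x, IsPathBasis F (Fin.init s) x) (hB : EdgeDivisible F (Fin.init s)) :
    EdgeDivisible F s := by
  intro g hg hr y hy f hf h0
  obtain ⟨f₁, hf₁, f₂, hf₂, rfl⟩ := exists_of_mem_X hf
  have hcov := fun x τ => exists_ev_eq (s := s) (x := x) (τ := τ)
  have hcov' := fun x σ => ev_init_eq_or (s := s) (x := x) (σ := σ)
  have hpair := fun y u v f => exists_eq_bar_mul_of_pair h2 s hGKM hA hB hg hr
    (y := y) (u := u) (v := v) (f := f)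
  have hsimple := (s (Fin.last l)).2
  set a := (s (Fin.last l)).1 with ha
  have hval : ∀ x σ, ev s σ = x →
      (diag F f₁ + cAct F (affineRoot P a) s (diag F f₂)) σ =
        f₁ (Fin.init σ) + bar P F (weylAct P x (affineRoot P a)) * f₂ (Fin.init σ) := by
    rintro _ σ rfl
    rfl
  set k₀ := f₁ + bar P F (weylAct P y (affineRoot P a)) • f₂ with hk₀
  have hk₀X : k₀ ∈ X F (Fin.init s) := add_mem hf₁ (Submodule.smul_mem _ _ hf₂)
  have hk₀z : ∀ τ, (ev (Fin.init s) τ = y ∨ ev (Fin.init s) τ = y * rootReflection P a) →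
      k₀ τ = 0 := by
    intro τ hτ
    obtain ⟨σ, rfl, hσ⟩ := hcov y τ hτ
    rw [← h0 σ hσ, hval y σ hσ]
    rfl
  by_cases hya : IsPosWt b (weylAct P (y * rootReflection P a)⁻¹ (affineRoot P g))
  · set z := rootReflection P g * y with hz
    have hza : rootReflection P g * (y * rootReflection P a) = z * rootReflection P a := by
      rw [hz, mul_assoc]
    obtain ⟨k, hkX, hk⟩ : ∃ k ∈ X F (Fin.init s), ∀ τ,
        (ev (Fin.init s) τ = z ∨ ev (Fin.init s) τ = z * rootReflection P a) →
        k₀ τ = bar P F (affineRoot P g) * k τ := by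
      -- The pair lemma expects the lower of `z` and `z s_l` first; otherwise the two edges are
      -- interchanged.
      by_cases hpos : IsPosWt b (weylAct P z (affineRoot P a))
      · exact hpair y z _ k₀ rfl rfl hpos hy hya hk₀X (fun τ h => hk₀z τ (Or.inl h))
          (fun τ h => hk₀z τ (Or.inr h))
      · obtain ⟨k, hkX, hk⟩ := hpair (y * rootReflection P a) (z * rootReflection P a) z k₀ hza
          (mul_rootReflection_cancel P z a).symm
          (by rw [weylAct_mul, weylAct_rootReflection_self, weylAct_neg, isPosWt_neg_weylAct]
              exact hpos) hya (by rwa [mul_rootReflection_cancel]) hk₀X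
          (fun τ h => hk₀z τ (Or.inr h))
          (fun τ h => hk₀z τ (Or.inl (by rwa [mul_rootReflection_cancel] at h)))
        exact ⟨k, hkX, fun τ h => hk τ h.symm⟩
    obtain ⟨n, hn⟩ := exists_weylAct_rootReflection P g (weylAct P y (affineRoot P a))
    refine ⟨diag F (k - (n : SymAlg P F) • f₂),
      diag_mem_X (sub_mem hkX (Submodule.smul_mem _ _ hf₂)), fun σ hσ => ?_⟩
    have h1 := hk _ (hcov' z σ hσ)
    rw [hval z σ hσ, hz, weylAct_mul, hn, bar_sub, bar_zsmul]
    change _ = bar P F (affineRoot P g) * (k (Fin.init σ) - n * f₂ (Fin.init σ))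
    simp only [hk₀, Pi.add_apply, Pi.smul_apply, smul_eq_mul] at h1
    linear_combination h1
  · rw [mul_inv_rev, rootReflection_inv] at hya
    obtain ⟨e, hr2⟩ := weylAct_simple_not_isPosWt hsimple _ hy hya
    have hz : rootReflection P g * y = y * rootReflection P a := by
      rw [hr2, inv_inv, ← mul_assoc, ← mul_assoc, mul_inv_cancel, one_mul]
    have hga : affineRoot P g = weylAct P y (affineRoot P a) := by
      rw [← e, weylAct_weylAct_inv]
    -- Here `γ = y(α_l)` and `f₁ = -γ f₂` at the relevant places, so the value over `y s_l` is `f₁ -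
    -- γ f₂ = -2γ f₂`.
    refine ⟨diag F ((-2 : SymAlg P F) • f₂), diag_mem_X (Submodule.smul_mem _ _ hf₂),
      fun σ hσ => ?_⟩
    rw [hz] at hσ
    have h1 := hk₀z (Fin.init σ) (by
      have := hcov' _ σ hσ
      rw [mul_rootReflection_cancel] at this
      exact this.symm)
    rw [hval _ σ hσ, bar_mul_simple, hga]
    change _ = _ * (-2 * f₂ (Fin.init σ))
    simp only [hk₀, Pi.add_apply, Pi.smul_apply, smul_eq_mul] at h1
    linear_combination h1

theorem isPathBasis_and_edgeDivisible (h2 : (2 : F) ≠ 0) {l : ℕ}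
    (s : Fin l → simpleAffineRoots b) (hGKM : GKM b F (evSet s)) :
    (∀ x, IsPathBasis F s x) ∧ EdgeDivisible F s := by
  induction l with
  | zero => exact ⟨isPathBasis_zero F s, edgeDivisible_zero s⟩
  | succ l ih =>
    obtain ⟨hA, hB⟩ := ih (Fin.init s) (hGKM.mono (evSet_init_subset s))
    exact ⟨isPathBasis_succ F h2 s hA hB, edgeDivisible_succ h2 s hGKM hA hB⟩

end Divisibility

/-! ### Paths as subsequences, homogeneity and the basis -/

section Paths

variable {ι V N : Type*} [AddCommGroup V] [Module ℚ V] [AddCommGroup N] [Module ℚ N]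
variable {P : RootPairing ι ℚ V N} {b : P.Base}

theorem pathSeq_addEdge {A : Type*} {l : ℕ} (e : TreeEdge A) (p : Fin l → TreeEdge A) :
    pathSeq (addEdge e p) = Fin.snoc (α := fun _ => Bool) (pathSeq p) (decide (e.color ≠ 0)) := by
  obtain ⟨h1, h2⟩ := pathSeq_snoc p e
  rw [← Fin.snoc_init_self (pathSeq (addEdge e p)), h1, h2]

section Structure

variable [Finite ι] [P.IsRootSystem] [P.IsCrystallographic] [P.IsReduced]

theorem root_of_mem_maxPaths {l : ℕ} {s : Fin l → simpleAffineRoots b} {x : affineWeylGroup P}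
    {p : Fin l → TreeEdge (simpleAffineRoots b)} (hp : p ∈ (tree s x).maxPaths) (i : Fin l) :
    (p i).root = s i := by
  induction l generalizing x with
  | zero => exact i.elim0
  | succ l ih =>
    obtain ⟨y, hy, hx⟩ := exists_lower (b := b) (a := (s (Fin.last l)).1) x
    obtain ⟨c₁, c₂, t, -, -, -, hL⟩ := exists_maxPaths_eq s hy hx
    rw [hL, List.mem_append, List.mem_map, List.mem_map] at hp
    rcases hp with ⟨q, hq, rfl⟩ | ⟨q, hq, rfl⟩ <;>
    · refine Fin.lastCases ?_ (fun j => ?_) i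
      · simp [addEdge]
      · rw [addEdge, Fin.snoc_castSucc]
        exact ih hq j

/-- Exactly one of the two colors at the root is zero, so paths from different subtrees differ in
the last entry. -/
theorem nodup_map_pathSeq {l : ℕ} (s : Fin l → simpleAffineRoots b) (x : affineWeylGroup P) :
    ((tree s x).maxPaths.map pathSeq).Nodup := by
  induction l generalizing x with
  | zero =>
    rw [tree]
    split_ifs <;> simp [Tree.maxPaths]
  | succ l ih =>
    obtain ⟨y, hy, hx⟩ := exists_lower (b := b) (a := (s (Fin.last l)).1) x
    obtain ⟨c₁, c₂, t, -, h₁, h₂, hL⟩ := exists_maxPaths_eq s hy hx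
    have hsnoc : ∀ (L : List (Fin l → TreeEdge (simpleAffineRoots b))) e,
        (L.map (addEdge e)).map pathSeq = (L.map pathSeq).map
          fun τ => Fin.snoc (α := fun _ => Bool) τ (decide (e.color ≠ 0)) := by
      intro L e
      simp only [List.map_map]
      exact List.map_congr_left fun p _ => pathSeq_addEdge e p
    have hinj : ∀ c : Bool, Function.Injective
        fun τ : Fin l → Bool => Fin.snoc (α := fun _ => Bool) τ c := fun c τ τ' h => by
      simpa using congrArg Fin.init h
    rw [hL, List.map_append, hsnoc, hsnoc, List.nodup_append]
    refine ⟨(ih _ _).map (hinj _), (ih _ _).map (hinj _), ?_⟩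
    intro σ hσ σ' hσ' e
    obtain ⟨τ, -, rfl⟩ := List.mem_map.1 hσ
    obtain ⟨τ', -, rfl⟩ := List.mem_map.1 hσ'
    have h := congrFun e (Fin.last l)
    simp only [Fin.snoc_last, h₁, h₂, decide_eq_decide, ne_eq, not_not] at h
    tauto

theorem mem_map_pathSeq {l : ℕ} {s : Fin l → simpleAffineRoots b} {x : affineWeylGroup P}
    {σ : Fin l → Bool} (hσ : ev s σ = x) : σ ∈ (tree s x).maxPaths.map pathSeq := by
  induction l generalizing x with
  | zero =>
    have hx : x = 1 := by simpa [ev] using hσ.symm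
    rw [tree, if_pos hx]
    exact List.mem_map.2 ⟨Fin.elim0, by simp [Tree.maxPaths], Subsingleton.elim _ _⟩
  | succ l ih =>
    obtain ⟨y, hy, hx⟩ := exists_lower (b := b) (a := (s (Fin.last l)).1) x
    obtain ⟨c₁, c₂, t, -, h₁, h₂, hL⟩ := exists_maxPaths_eq s hy hx
    have hτ : ev (Fin.init s) (Fin.init σ) =
        if σ (Fin.last l) then x * rootReflection P (s (Fin.last l)).1 else x := by
      rw [ev_succ] at hσ
      split_ifs at hσ ⊢
      · rw [← hσ, mul_rootReflection_cancel]
      · rw [← hσ, mul_one]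
    have hlift : ∀ (z : affineWeylGroup P) (e : TreeEdge (simpleAffineRoots b)),
        ev (Fin.init s) (Fin.init σ) = z → decide (e.color ≠ 0) = σ (Fin.last l) →
        ∃ p ∈ (tree (Fin.init s) z).maxPaths, pathSeq (addEdge e p) = σ := by
      intro z e hz he
      obtain ⟨p, hp, hp'⟩ := List.mem_map.1 (ih hz)
      exact ⟨p, hp, by rw [pathSeq_addEdge, hp', he, Fin.snoc_init_self]⟩
    rw [hL, List.mem_map]
    by_cases hlow : ev (Fin.init s) (Fin.init σ) = y ∧ (x = y ↔ σ (Fin.last l) = false)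
    · obtain ⟨p, hp, hp'⟩ := hlift y ⟨c₁, s (Fin.last l), t⟩ hlow.1 (by
        simp only [ne_eq, h₁, hlow.2]
        cases σ (Fin.last l) <;> rfl)
      exact ⟨_, List.mem_append_left _ (List.mem_map_of_mem hp), hp'⟩
    · obtain ⟨hz, hc⟩ : ev (Fin.init s) (Fin.init σ) = y * rootReflection P (s (Fin.last l)).1 ∧
          (x = y ↔ σ (Fin.last l) = true) := by
        by_cases hxy : x = y
        · cases hc : σ (Fin.last l)
          · simp [hc] at hτ
            exact absurd ⟨hτ.trans hxy, by simp [hxy, hc]⟩ hlow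
          · simp [hc] at hτ
            exact ⟨by rw [hτ, hxy], by simp [hxy]⟩
        · have hxz := hx.resolve_left hxy
          cases hc : σ (Fin.last l)
          · simp [hc] at hτ
            exact ⟨hτ.trans hxz, by simp [hxy]⟩
          · simp [hc] at hτ
            rw [hxz, mul_rootReflection_cancel] at hτ
            exact absurd ⟨hτ, by simp [hxy, hc]⟩ hlow
      obtain ⟨p, hp, hp'⟩ := hlift _ ⟨c₂, s (Fin.last l), .left⟩ hz (by
        simp only [ne_eq, h₂, not_not, hc]
        cases σ (Fin.last l) <;> rfl)
      exact ⟨_, List.mem_append_right _ (List.mem_map_of_mem hp), hp'⟩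

theorem maxPathSeq_bijective {l : ℕ} (s : Fin l → simpleAffineRoots b) (x : affineWeylGroup P) :
    Function.Bijective (maxPathSeq s x) := by
  constructor
  · intro i j h
    have h' : pathSeq (maxPath s x i) = pathSeq (maxPath s x j) := congrArg Subtype.val h
    have hinj := List.inj_on_of_nodup_map (nodup_map_pathSeq s x)
      (List.get_mem _ i) (List.get_mem _ j) h'
    exact (List.Nodup.of_map _ (nodup_map_pathSeq s x)).injective_get hinj
  · rintro ⟨σ, hσ⟩
    obtain ⟨p, hp, hp'⟩ := List.mem_map.1 (mem_map_pathSeq hσ)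
    obtain ⟨i, hi⟩ := List.get_of_mem hp
    refine ⟨i, Subtype.ext ?_⟩
    change pathSeq ((tree s x).maxPaths.get i) = σ
    rw [hi, hp']

end Structure

variable [P.IsCrystallographic] (F : Type*) [Field F]

theorem exists_pathElement_mem_pow {l : ℕ} (s : Fin l → simpleAffineRoots b)
    (p : Fin l → TreeEdge (simpleAffineRoots b)) :
    ∃ d : ℕ, ∀ σ, pathElement F s p σ ∈
      (LinearMap.range (SymmetricAlgebra.ι F (WeightSpace P F))) ^ d := by
  induction l with
  | zero =>
    refine ⟨0, fun σ => ?_⟩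
    rw [pow_zero]
    exact Submodule.one_le.1 le_rfl
  | succ l ih =>
    obtain ⟨d, hd⟩ := ih (Fin.init s) (Fin.init p)
    classical
    by_cases h : (p (Fin.last l)).tilt = .left
    · refine ⟨d + 1, fun σ => ?_⟩
      rw [pathElement_succ_apply, if_pos h, pow_succ']
      exact Submodule.smul_mem _ _ (Submodule.mul_mem_mul
        (add_mem (LinearMap.mem_range_self _ _) (LinearMap.mem_range_self _ _)) (hd _))
    · refine ⟨d, fun σ => ?_⟩
      rw [pathElement_succ_apply, if_neg h]
      exact hd _

theorem isHomogeneousFun_pathElement {l : ℕ} (s : Fin l → simpleAffineRoots b)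
    (p : Fin l → TreeEdge (simpleAffineRoots b)) :
    IsHomogeneousFun P F (pathElement F s p) := by
  obtain ⟨d, hd⟩ := exists_pathElement_mem_pow F s p
  refine ⟨2 * d, fun σ => ?_⟩
  rw [symGrade, if_pos ⟨by positivity, even_two_mul _⟩]
  simpa using hd σ

theorem treeComb_eq_sum {l : ℕ} (s : Fin l → simpleAffineRoots b) (x : affineWeylGroup P)
    (c : (Fin l → TreeEdge (simpleAffineRoots b)) → SymAlg P F) (τ : Fin l → Bool) :
    treeComb F s x c τ =
      ∑ i : Fin (numLeaves s x), c (maxPath s x i) * pathElement F s (maxPath s x i) τ :=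
  (Fin.sum_univ_fun_getElem _ fun p => c p * pathElement F s p τ).symm

variable {F} in
/-- The restriction of `b_π` to `I(s)_x` for the maximal path `π` number `i` of `T(s, x)`. -/
def pathVector (h2 : (2 : F) ≠ 0) {l : ℕ} (s : Fin l → simpleAffineRoots b)
    (x : affineWeylGroup P) (i : Fin (numLeaves s x)) : XAt F s x :=
  ⟨fun σ => pathElement F s (maxPath s x i) σ.1,
    pathElement F s (maxPath s x i), pathElement_mem_X F h2 s _, rfl⟩

variable {F} in
theorem sum_smul_pathVector_apply (h2 : (2 : F) ≠ 0) {l : ℕ} (s : Fin l → simpleAffineRoots b)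
    (x : affineWeylGroup P) (c : (Fin l → TreeEdge (simpleAffineRoots b)) → SymAlg P F)
    (σ : subseqsAt s x) :
    (∑ i, c (maxPath s x i) • pathVector h2 s x i : XAt F s x).1 σ = treeComb F s x c σ.1 := by
  rw [treeComb_eq_sum, Submodule.coe_sum, Finset.sum_apply]
  rfl

variable {F} in
theorem exists_basis_pathVector [Finite ι] [P.IsRootSystem] [P.IsReduced] (h2 : (2 : F) ≠ 0)
    {l : ℕ} (s : Fin l → simpleAffineRoots b) (x : affineWeylGroup P)
    (h : IsPathBasis F s x) :
    ∃ v : Module.Basis (Fin (numLeaves s x)) (SymAlg P F) (XAt F s x),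
      ∀ i, v i = pathVector h2 s x i := by
  have hinj : Function.Injective (maxPath s x) := fun i j e =>
    (maxPathSeq_bijective s x).1 (Subtype.ext (congrArg pathSeq e))
  refine ⟨Module.Basis.mk (v := pathVector h2 s x) ?_ ?_, fun i => Module.Basis.mk_apply _ _ i⟩
  · rw [Fintype.linearIndependent_iff]
    intro c hc i
    -- `IsPathBasis` has coefficients indexed by paths. Distinct leaves have distinct paths, so
    -- coefficients indexed by leaves extend by zero.
    have hext : ∀ i, Function.extend (maxPath s x) c 0 (maxPath s x i) = c i :=
      fun i => hinj.extend_apply _ _ i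
    rw [← hext i]
    refine h.indep _ (fun τ hτ => ?_) _ (List.get_mem _ i)
    rw [← sum_smul_pathVector_apply h2 s x _ ⟨τ, hτ⟩]
    simp only [hext, hc]
    rfl
  · rintro ⟨_, f, hf, rfl⟩ -
    obtain ⟨c, hc⟩ := h.span f hf
    have e : (⟨_, f, hf, rfl⟩ : XAt F s x) = ∑ i, c (maxPath s x i) • pathVector h2 s x i := by
      refine Subtype.ext (funext fun σ => ?_)
      rw [sum_smul_pathVector_apply h2 s x c σ]
      exact hc σ.1 σ.2
    rw [e]
    exact Submodule.sum_mem _ fun i _ => Submodule.smul_mem _ _ (Submodule.subset_span ⟨i, rfl⟩)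

end Paths

end BottSamelson

end

open Classical in
theorem corollary5 {ι V N : Type*} [Finite ι] [AddCommGroup V] [Module ℚ V]
    [AddCommGroup N] [Module ℚ N] (P : RootPairing ι ℚ V N) [P.IsRootSystem]
    [P.IsCrystallographic] [P.IsReduced] [P.IsIrreducible] (b : P.Base)
    (F : Type*) [Field F] (hF : ringChar F ≠ 2)
    {l : ℕ} (s : Fin l → BottSamelson.simpleAffineRoots b)
    (hGKM : BottSamelson.GKM b F (BottSamelson.evSet s))
    (x : BottSamelson.affineWeylGroup P) :
    -- the maximal paths of `T(s, x)` are identified with the elements of `I(s)_x`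
    Function.Bijective (BottSamelson.maxPathSeq s x) ∧
    -- the homogeneous basis of `X(s)^x`
    (∃ v : Module.Basis (Fin (BottSamelson.numLeaves s x)) (BottSamelson.SymAlg P F)
        (BottSamelson.XAt F s x),
      (∀ i, BottSamelson.IsHomogeneousFun P F (v i).1) ∧
      ∀ i j, (v i).1 (BottSamelson.maxPathSeq s x j) =
        BottSamelson.pathProduct F s (BottSamelson.maxPath s x i) (BottSamelson.maxPath s x j)) ∧
    -- the recursive rule for the products of paths
    (∀ p q : Fin 0 → BottSamelson.TreeEdge (BottSamelson.simpleAffineRoots b),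
      BottSamelson.pathProduct F (Fin.take 0 (Nat.zero_le l) s) p q = 1) ∧
    (∀ (k : ℕ) (hk : k + 1 ≤ l)
      (p q : Fin (k + 1) → BottSamelson.TreeEdge (BottSamelson.simpleAffineRoots b)),
      (BottSamelson.tree s x).IsLeafPath hk p → (BottSamelson.tree s x).IsLeafPath hk q →
      BottSamelson.pathProduct F (Fin.take (k + 1) hk s) p q =
        if (p (Fin.last k)).tilt = .left then
          (2 : F)⁻¹ •
            ((BottSamelson.bar P F (BottSamelson.weylAct P
                (BottSamelson.ev (Fin.take k (Nat.le_of_succ_le hk) s)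
                  (BottSamelson.pathSeq (Fin.init p)))
                (BottSamelson.affineRoot P (p (Fin.last k)).root.1)) +
              BottSamelson.bar P F (BottSamelson.weylAct P
                (BottSamelson.ev (Fin.take k (Nat.le_of_succ_le hk) s)
                  (BottSamelson.pathSeq (Fin.init q)))
                (BottSamelson.affineRoot P (q (Fin.last k)).root.1))) *
              BottSamelson.pathProduct F (Fin.take k (Nat.le_of_succ_le hk) s)
                (Fin.init p) (Fin.init q))
        else
          BottSamelson.pathProduct F (Fin.take k (Nat.le_of_succ_le hk) s)
            (Fin.init p) (Fin.init q)) := by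
  have h2 : (2 : F) ≠ 0 := Ring.two_ne_zero hF
  refine ⟨BottSamelson.maxPathSeq_bijective s x, ?_, fun _ _ => rfl, ?_⟩
  · obtain ⟨v, hv⟩ := BottSamelson.exists_basis_pathVector h2 s x
      ((BottSamelson.isPathBasis_and_edgeDivisible h2 s hGKM).1 x)
    refine ⟨v, fun i => ?_, fun i j => by rw [hv]; rfl⟩
    obtain ⟨d, hd⟩ := BottSamelson.isHomogeneousFun_pathElement F s (BottSamelson.maxPath s x i)
    exact ⟨d, fun σ => by rw [hv]; exact hd σ.1⟩
  · rintro k hk p q ⟨p', hp', rfl⟩ ⟨q', hq', rfl⟩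
    -- The rule involves `r(λ)` and `r(μ)` but `b_π` only `r(λ)`; both are the root at this position
    -- of `s`.
    have hroot : (Fin.take (k + 1) hk q' (Fin.last k)).root
        = (Fin.take (k + 1) hk p' (Fin.last k)).root :=
      (BottSamelson.root_of_mem_maxPaths hq' _).trans
        (BottSamelson.root_of_mem_maxPaths hp' _).symm
    rw [hroot]
    exact BottSamelson.pathElement_succ_apply F (Fin.take (k + 1) hk s) _ _
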